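/- Work in the category of compactly generated Hausdorff spaces; function spaces carry the compactly generated topology associated with the compact-open topology, a (Hurewicz) fibration is a map with the homotopy lifting property for all such spaces, and a cofibration is an inclusion with the homotopy extension property for all such spaces. Let $J$ be a directed set and let $\{(X_j,A_j),\,p_{ij}\colon (X_i,A_i)\to (X_j,A_j)\ (j\le i)\}$ be an inverse system of finite CW pairs indexed by $J$. Let $X$ be a compact Hausdorff space, $A\subset X$ a closed subspace whose inclusion is a cofibration, and $h_j\colon (X,A)\to (X_j,A_j)$ compatible maps of pairs that induce a homeomorphism of pairs $(X,A)\cong\varprojlim_j (X_j,A_j)$. Let $p\colon E\to B$ be a fibration in which $E$ and $B$ have the homotopy type of CW complexes. Let $m\in J$, and let $\mathcal D_m$ be a lifting problem at stage $m$: maps $g_m\colon A_m\to E$ and $f_m\colon X_m\to B$ with $p\circ g_m=f_m|_{A_m}$. For $j\ge m$ let $\mathcal D_j$ be the lifting problem given by $g_j=g_m\circ p_{jm}|_{A_j}$ and $f_j=f_m\circ p_{jm}$, and let $\mathcal D$ be the lifting problem on $(X,A)$ given by $g=g_m\circ h_m|_A$ and $f=f_m\circ h_m$. Write $\Gamma(\mathcal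 D_j)$ for the space of solutions of $\mathcal D_j$, that is, of maps $s\colon X_j\to E$ with $s|_{A_j}=g_j$ and $p\circ s=f_j$, topologized as a subspace (in the above category) of the space of maps $X_j\to E$; define $\Gamma(\mathcal D)$ in the same way. Let $\tilde f_m\in\Gamma(\mathcal D_m)$ be any solution, and take $\tilde f_j=\tilde f_m\circ p_{jm}$ and $\tilde f=\tilde f_m\circ h_m$ as base points of $\Gamma(\mathcal D_j)$ $(j\ge m)$ and $\Gamma(\mathcal D)$. Then for every $n\ge 0$ the map of based sets $$\varinjlim_{j\ge m}\pi_n(\Gamma(\mathcal D_j);\tilde f_j)\longrightarrow \pi_n(\Gamma(\mathcal D);\tilde f)$$ induced by composition with the maps $h_j$ is an isomorphism, i.e. a base point preserving bijection, where the direct limit is taken in the category of sets. -/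

import Mathlib

open scoped unitInterval Topology Topology.Homotopy

universe u w

namespace LimSection

/-! ### Compactly generated spaces, fibrations, cofibrations, CW type -/

/-- A continuous map stays continuous when both topologies are replaced by the associated
compactly generated topologies. -/
theorem continuous_compactlyGenerated {Y Z : Type*} [TopologicalSpace Y] [TopologicalSpace Z]
    {f : Y → Z} (hf : Continuous f) :
    @Continuous Y Z (TopologicalSpace.compactlyGenerated.{u} Y)
      (TopologicalSpace.compactlyGenerated.{u} Z) f := by
  refine continuous_from_compactlyGenerated
    (t := TopologicalSpace.compactlyGenerated.{u} Z) f fun S g => ?_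
  let F : (Σ (i : (T : CompHaus.{u}) × C(T, Z)), i.fst) → Z := fun ⟨⟨_, i⟩, s⟩ => i s
  let fg : C(S, Z) := ⟨f ∘ g, hf.comp g.continuous⟩
  have h : @Continuous _ Z inferInstance (TopologicalSpace.compactlyGenerated.{u} Z) F :=
    continuous_coinduced_rng
  exact (@continuous_sigma_iff _ _ _ _ (TopologicalSpace.compactlyGenerated.{u} Z) F).1 h ⟨S, fg⟩

/-- A Hurewicz fibration in the category of compactly generated Hausdorff spaces: the homotopy
lifting property for all compactly generated Hausdorff spaces. -/
def IsFibration {E B : Type u} [TopologicalSpace E] [TopologicalSpace B] (p : C(E, B)) : Prop :=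
  ∀ (Z : Type u) [TopologicalSpace Z] [T2Space Z] [CompactlyGeneratedSpace Z]
    (H : C(Z × I, B)) (h₀ : C(Z, E)), (∀ z, p (h₀ z) = H (z, 0)) →
    ∃ G : C(Z × I, E), (∀ z, G (z, 0) = h₀ z) ∧ ∀ y, p (G y) = H y

/-- The inclusion of `A` in `X` is a closed cofibration: `A` is closed, and the inclusion has the
homotopy extension property for all compactly generated Hausdorff spaces. -/
def IsClosedCofibration {X : Type u} [TopologicalSpace X] (A : Set X) : Prop :=
  IsClosed A ∧
  ∀ (Y : Type u) [TopologicalSpace Y] [T2Space Y] [CompactlyGeneratedSpace Y]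
    (f : C(X, Y)) (H : C(A × I, Y)), (∀ a : A, H (a, 0) = f a) →
    ∃ G : C(X × I, Y), (∀ x, G (x, 0) = f x) ∧ ∀ (a : A) (t : I), G (a, t) = H (a, t)

/-- `E` has the homotopy type of a CW complex. -/
def HasCWType (E : Type u) [TopologicalSpace E] : Prop :=
  ∃ (K : Type u) (_ : TopologicalSpace K) (_ : T2Space K)
    (_ : Topology.CWComplex (Set.univ : Set K)), Nonempty (ContinuousMap.HomotopyEquiv E K)

/-- `(X, A)` is a finite CW pair: `X` is a finite CW complex and `A` is a subcomplex. -/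
def IsFiniteCWPair {X : Type u} [TopologicalSpace X] (A : Set X) : Prop :=
  T2Space X ∧ ∃ _ : Topology.CWComplex (Set.univ : Set X),
    Topology.CWComplex.Finite (Set.univ : Set X) ∧
    ∃ K : Topology.RelCWComplex.Subcomplex (Set.univ : Set X), (K : Set X) = A

/-! ### Inverse systems of pairs and their limits -/

/-- An inverse system of pairs of spaces `(X j, A j)` indexed by a preorder, with bonding maps
`p : (X j, A j) → (X i, A i)` for `i ≤ j`. -/
structure PairSystem (ι : Type w) [Preorder ι] where
  X : ι → Type u
  [top : ∀ i, TopologicalSpace (X i)]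
  A : ∀ i, Set (X i)
  p : ∀ {i j : ι}, i ≤ j → C(X j, X i)
  mapsTo : ∀ {i j : ι} (h : i ≤ j), Set.MapsTo (p h) (A j) (A i)
  p_refl : ∀ (i : ι) (x : X i), p (le_refl i) x = x
  p_comp : ∀ {i j k : ι} (hij : i ≤ j) (hjk : j ≤ k) (x : X k),
    p hij (p hjk x) = p (hij.trans hjk) x

attribute [instance] PairSystem.top

namespace PairSystem

variable {ι : Type w} [Preorder ι]

/-- The inverse limit of the spaces `X j`, as a subspace of their product. -/
def lim (S : PairSystem.{u, w} ι) : Set (∀ i, S.X i) :=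
  {x | ∀ (i j : ι) (h : i ≤ j), S.p h (x j) = x i}

/-- The inverse limit of the subspaces `A j`, inside the inverse limit of the `X j`. -/
def limSub (S : PairSystem.{u, w} ι) : Set S.lim :=
  {x | ∀ i, x.1 i ∈ S.A i}

/-- A compatible family of maps of pairs `h j : (X, A) → (X j, A j)`. -/
structure Cone (S : PairSystem.{u, w} ι) {X : Type u} [TopologicalSpace X] (A : Set X) where
  h : ∀ j, C(X, S.X j)
  mapsTo : ∀ j, Set.MapsTo (h j) A (S.A j)
  compat : ∀ {i j : ι} (hij : i ≤ j) (x : X), S.p hij (h j x) = h i x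

/-- The map to the inverse limit induced by a compatible family. -/
def Cone.toLim {S : PairSystem.{u, w} ι} {X : Type u} [TopologicalSpace X] {A : Set X}
    (c : S.Cone A) (x : X) : S.lim :=
  ⟨fun j => c.h j x, fun _ _ hij => c.compat hij x⟩

/-- `(X, A)` is the inverse limit of the pairs `(X j, A j)`: the induced map is a homeomorphism
of `X` onto the limit of the `X j`, taking `A` onto the limit of the `A j`. -/
def Cone.IsLimit {S : PairSystem.{u, w} ι} {X : Type u} [TopologicalSpace X] {A : Set X}
    (c : S.Cone A) : Prop :=
  IsHomeomorph c.toLim ∧ c.toLim '' A = S.limSub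

end PairSystem

/-! ### Lifting problems and their spaces of solutions -/

/-- A lifting problem: a commutative square with sides `A ⊆ X`, `g : A → E`, `p : E → B` and
`f : X → B`. -/
structure LiftingProblem {X E B : Type u} [TopologicalSpace X] [TopologicalSpace E]
    [TopologicalSpace B] (A : Set X) (p : C(E, B)) where
  f : C(X, B)
  g : C(A, E)
  comm : ∀ a : A, p (g a) = f a

namespace LiftingProblem

variable {X X' X'' E B : Type u} [TopologicalSpace X] [TopologicalSpace X'] [TopologicalSpace X'']
  [TopologicalSpace E] [TopologicalSpace B] {A : Set X} {A' : Set X'} {A'' : Set X''} {p : C(E, B)}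

/-- The lifting problem obtained by precomposition with a map of pairs `k : (X', A') → (X, A)`. -/
def pullback (D : LiftingProblem A p) (k : C(X', X)) (hk : Set.MapsTo k A' A) :
    LiftingProblem A' p where
  f := D.f.comp k
  g := D.g.comp ⟨hk.restrict k A' A, k.continuous.restrict hk⟩
  comm a := D.comm ⟨k a, hk a.2⟩

/-- The set `Γ(D)` of solutions `s : X → E` of the lifting problem. -/
def Γ (D : LiftingProblem A p) : Type u :=
  {s : C(X, E) // (∀ a : A, s a = D.g a) ∧ ∀ x, p (s x) = D.f x}

/-- The topology of `Γ(D)`: the compactly generated topology associated with the subspace topology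
that `Γ(D)` inherits from the compact-open topology. -/
instance (D : LiftingProblem A p) : TopologicalSpace D.Γ :=
  @TopologicalSpace.compactlyGenerated.{u}
    {s : C(X, E) // (∀ a : A, s a = D.g a) ∧ ∀ x, p (s x) = D.f x} instTopologicalSpaceSubtype

/-- Let `D` and `D'` be lifting problems on `(X, A)` and `(X', A')`. A map of pairs
`k : (X', A') → (X, A)` with `D'.f = D.f ∘ k` and `D'.g = D.g ∘ k` induces a continuous map
`Γ(D) → Γ(D')` by precomposition. -/
def precomp (D : LiftingProblem A p) (D' : LiftingProblem A' p) (k : C(X', X))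
    (hk : Set.MapsTo k A' A) (hf : ∀ x, D'.f x = D.f (k x))
    (hg : ∀ a : A', D'.g a = D.g ⟨k a, hk a.2⟩) : C(D.Γ, D'.Γ) where
  toFun s := ⟨s.1.comp k, fun a => (s.2.1 ⟨k a, hk a.2⟩).trans (hg a).symm,
    fun x => (s.2.2 (k x)).trans (hf x).symm⟩
  continuous_toFun := continuous_compactlyGenerated.{u}
    (Y := {s : C(X, E) // (∀ a : A, s a = D.g a) ∧ ∀ x, p (s x) = D.f x})
    (Z := {s : C(X', E) // (∀ a : A', s a = D'.g a) ∧ ∀ x, p (s x) = D'.f x})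
    (((ContinuousMap.continuous_precomp k).comp continuous_subtype_val).subtype_mk _)

/-- The solution of the pulled back lifting problem given by a solution of the original one. -/
def Γ.pullback {D : LiftingProblem A p} (s : D.Γ) (k : C(X', X)) (hk : Set.MapsTo k A' A) :
    (D.pullback k hk).Γ :=
  D.precomp (D.pullback k hk) k hk (fun _ => rfl) (fun _ => rfl) s

end LiftingProblem

/-! ### Induced maps on homotopy groups -/

/-- The map induced on `n`-fold loops by a based map `f : (Y, y) → (Z, z)`. -/
def genLoopMap {Y Z : Type*} [TopologicalSpace Y] [TopologicalSpace Z] (n : ℕ) (f : C(Y, Z))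
    {y : Y} {z : Z} (h : f y = z) (a : GenLoop (Fin n) Y y) : GenLoop (Fin n) Z z :=
  ⟨f.comp a.1, fun t ht => (congrArg f (a.2 t ht)).trans h⟩

/-- The base point of `π_n(Y, y)`, the class of the constant map. -/
def piBase {Y : Type*} [TopologicalSpace Y] (n : ℕ) (y : Y) : π_ n Y y :=
  Quotient.mk (GenLoop.Homotopic.setoid (Fin n) y) GenLoop.const

/-- Maps of based sets `(α, a) → (β, b)`. -/
structure BasedMap {α β : Type*} (a : α) (b : β) where
  toFun : α → β
  map_base : toFun a = b

instance {α β : Type*} (a : α) (b : β) : FunLike (BasedMap a b) α β where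
  coe := BasedMap.toFun
  coe_injective φ ψ h := by cases φ; cases ψ; congr

/-- The map of based sets `π_n(Y, y) → π_n(Z, z)` induced by a based map `f : (Y, y) → (Z, z)`. -/
def piMap {Y Z : Type*} [TopologicalSpace Y] [TopologicalSpace Z] (n : ℕ) (f : C(Y, Z))
    {y : Y} {z : Z} (h : f y = z) : BasedMap (piBase n y) (piBase n z) where
  toFun := Quotient.map (genLoopMap n f h) fun _ _ hab => hab.map fun K => K.compContinuousMap f
  map_base := congrArg (Quotient.mk _) (Subtype.ext (ContinuousMap.ext fun _ => h))

/-! ### The direct system of homotopy groups of solution spaces -/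

section System

variable {ι : Type w} [Preorder ι] (S : PairSystem.{u, w} ι) {X : Type u} [TopologicalSpace X]
  {A : Set X} {E B : Type u} [TopologicalSpace E] [TopologicalSpace B] {p : C(E, B)} {m : ι}
  (D : LiftingProblem (S.A m) p)

/-- The lifting problem on `(X j, A j)` pulled back from stage `m`, for `j ≥ m`. -/
def stage (j : Set.Ici m) : LiftingProblem (S.A j) p :=
  D.pullback (S.p j.2) (S.mapsTo j.2)

/-- The lifting problem on `(X, A)` pulled back from stage `m`. -/
def limProblem (c : S.Cone A) : LiftingProblem A p :=
  D.pullback (c.h m) (c.mapsTo m)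

/-- The base point at stage `j` determined by a base point at stage `m`. -/
def stageBase (s : D.Γ) (j : Set.Ici m) : (stage S D j).Γ :=
  s.pullback (S.p j.2) (S.mapsTo j.2)

/-- The base point of the solution space over `(X, A)` determined by a base point at stage `m`. -/
def limBase (c : S.Cone A) (s : D.Γ) : (limProblem S D c).Γ :=
  s.pullback (c.h m) (c.mapsTo m)

/-- The transition map between the solution spaces at stages `j ≤ k`. -/
def trans {j k : Set.Ici m} (h : j ≤ k) : C((stage S D j).Γ, (stage S D k).Γ) :=
  (stage S D j).precomp (stage S D k) (S.p h) (S.mapsTo h)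
    (fun x => congrArg D.f (S.p_comp j.2 h x).symm)
    (fun a => congrArg D.g (Subtype.ext (S.p_comp j.2 h a).symm))

/-- The map from the solution space at stage `j` to the solution space over `(X, A)`. -/
def toLimProblem (c : S.Cone A) (j : Set.Ici m) : C((stage S D j).Γ, (limProblem S D c).Γ) :=
  (stage S D j).precomp (limProblem S D c) (c.h j) (c.mapsTo j)
    (fun x => congrArg D.f (c.compat j.2 x).symm)
    (fun a => congrArg D.g (Subtype.ext (c.compat j.2 a).symm))

theorem trans_base (s : D.Γ) {j k : Set.Ici m} (h : j ≤ k) :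
    trans S D h (stageBase S D s j) = stageBase S D s k :=
  Subtype.ext (ContinuousMap.ext fun x => congrArg s.1 (S.p_comp j.2 h x))

theorem toLimProblem_base (c : S.Cone A) (s : D.Γ) (j : Set.Ici m) :
    toLimProblem S D c j (stageBase S D s j) = limBase S D c s :=
  Subtype.ext (ContinuousMap.ext fun x => congrArg s.1 (c.compat j.2 x))

/-- The set `π_n(Γ(D_j))`, at stage `j`. -/
abbrev piStage (n : ℕ) (s : D.Γ) (j : Set.Ici m) : Type u :=
  π_ n (stage S D j).Γ (stageBase S D s j)

/-- The transition maps `π_n(Γ(D_j)) → π_n(Γ(D_k))`, for `j ≤ k`. -/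
def piTrans (n : ℕ) (s : D.Γ) (j k : Set.Ici m) (h : j ≤ k) :
    BasedMap (piBase n (stageBase S D s j)) (piBase n (stageBase S D s k)) :=
  piMap n (trans S D h) (trans_base S D s h)

instance (n : ℕ) (s : D.Γ) : DirectedSystem (piStage S D n s) (piTrans S D n s · · ·) where
  map_self j := by
    rintro ⟨a⟩
    refine congrArg (Quotient.mk _) (Subtype.ext (ContinuousMap.ext fun t => ?_))
    exact Subtype.ext (ContinuousMap.ext fun x => congrArg (a.1 t).1 (S.p_refl j x))
  map_map i j k hij hjk := by
    rintro ⟨a⟩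
    refine congrArg (Quotient.mk _) (Subtype.ext (ContinuousMap.ext fun t => ?_))
    exact Subtype.ext (ContinuousMap.ext fun x => congrArg (a.1 t).1 (S.p_comp _ _ x))

variable [IsDirectedOrder ι]

instance (m : ι) : IsDirectedOrder (Set.Ici m) where
  directed j k := by
    obtain ⟨l, hj, hk⟩ := exists_ge_ge j.1 k.1
    exact ⟨⟨l, le_trans j.2 hj⟩, hj, hk⟩

/-- The direct limit, in the category of sets, of the `π_n(Γ(D_j))` over the stages `j ≥ m`. -/
abbrev ColimPi (n : ℕ) (s : D.Γ) : Type (max u w) :=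
  DirectLimit (piStage S D n s) (piTrans S D n s)

/-- The base point of the direct limit, represented by the base point at stage `m`. -/
def colimBase (n : ℕ) (s : D.Γ) : ColimPi S D n s :=
  Quotient.mk _ ⟨⟨m, le_refl m⟩, piBase n _⟩

/-- The natural map from the direct limit of the `π_n(Γ(D_j))` to `π_n(Γ(D))`, where `D` is
the lifting problem over `(X, A)`. -/
def naturalMap (c : S.Cone A) (n : ℕ) (s : D.Γ) :
    ColimPi S D n s → π_ n (limProblem S D c).Γ (limBase S D c s) :=
  DirectLimit.lift (piTrans S D n s)
    (fun j => piMap n (toLimProblem S D c j) (toLimProblem_base S D c s j)) (by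
      rintro i j h ⟨a⟩
      refine congrArg (Quotient.mk _) (Subtype.ext (ContinuousMap.ext fun t => ?_))
      exact Subtype.ext (ContinuousMap.ext fun x => congrArg (a.1 t).1 (c.compat h x).symm))

end System

end LimSection

universe v v'

namespace LimSection

/-! ### Cofibrations and the homotopy lifting property -/

section Cofibrations

/-! All homotopy groups are handled at once by a relative approximation property, `IsWeakColimit`. A
direct system `U j → L` has it if, for every compact Hausdorff cofibration `S ⊆ T`, a map `T → L`
whose restriction to `S` comes from stage `i` is homotopic rel `S` to one that comes from a later
stage and extends the given map on `S`. For `(Iⁿ, ∂Iⁿ)` this makes the map from the direct limit of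
the `π_n` surjective. For `Iⁿ × I` relative to its two ends and `∂Iⁿ × I` it makes it injective.
Neither argument depends on a group structure, so `n = 0` is not special.

The property passes to levelwise pullbacks along fibrations (`IsWeakColimit.pullback`). The spaces
of lifting problems are the pullbacks of `C(X, B) → C(A, B) ← C(A, E)`, and solutions form the fibre
of `C(X, E)` over a given problem. Both pullbacks are along fibrations, because `p` is a fibration
and the inclusions of the `A j` and of `A` are cofibrations. It remains to treat the systems `C(X j,
K) → C(X, K)` and `C(A j, K) → C(A, K)` for `K` of CW type.

For `K` open in a finite-dimensional vector space, a partition of unity approximates a map on `T ×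
X` by one on some `T × X k` without changing it over `S`, and a straight-line homotopy joins the two
(`isWeakColimit_maps_of_isOpen`). A finite cell complex is homotopy dominated by such an open set,
by induction on the cells (`IsOpenDominated.attach`), and the property is inherited under domination
(`IsWeakColimit.of_domination`). Compact sets in a CW complex lie in finite subcomplexes, which
gives all CW complexes; domination once more gives all spaces of CW type. -/

/-- Two maps defined on closed subsets and agreeing on the intersection have a common extension to
the union. -/
theorem exists_glue {Y Z : Type*} [TopologicalSpace Y] [TopologicalSpace Z] {C₁ C₂ : Set Y}
    (h₁ : IsClosed C₁) (h₂ : IsClosed C₂) (f₁ : C(C₁, Z)) (f₂ : C(C₂, Z))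
    (h : ∀ y (a : y ∈ C₁) (b : y ∈ C₂), f₁ ⟨y, a⟩ = f₂ ⟨y, b⟩) :
    ∃ g : C({y | y ∈ C₁ ∨ y ∈ C₂}, Z), (∀ y (a : y ∈ C₁), g ⟨y, Or.inl a⟩ = f₁ ⟨y, a⟩) ∧
      ∀ y (b : y ∈ C₂), g ⟨y, Or.inr b⟩ = f₂ ⟨y, b⟩ := by
  classical
  let g : {y | y ∈ C₁ ∨ y ∈ C₂} → Z := fun y =>
    if hy : y.1 ∈ C₁ then f₁ ⟨y, hy⟩ else f₂ ⟨y, y.2.resolve_left hy⟩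
  have g₁ : ∀ y (a : y ∈ C₁), g ⟨y, Or.inl a⟩ = f₁ ⟨y, a⟩ := fun y a => dif_pos a
  have g₂ : ∀ y (b : y ∈ C₂), g ⟨y, Or.inr b⟩ = f₂ ⟨y, b⟩ := fun y b => by
    by_cases a : y ∈ C₁
    · exact (dif_pos a).trans (h y a b)
    · exact dif_neg a
  refine ⟨⟨g, ?_⟩, g₁, g₂⟩
  have key : ContinuousOn g (Subtype.val ⁻¹' C₁ ∪ Subtype.val ⁻¹' C₂) := by
    refine ContinuousOn.union_of_isClosed ?_ ?_ (h₁.preimage continuous_subtype_val)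
      (h₂.preimage continuous_subtype_val)
    · rw [continuousOn_iff_continuous_domRestrict]
      refine (f₁.continuous.comp (continuous_subtype_val.comp continuous_subtype_val
        |>.subtype_mk fun y => y.2)).congr fun y => (g₁ _ y.2).symm
    · rw [continuousOn_iff_continuous_domRestrict]
      refine (f₂.continuous.comp (continuous_subtype_val.comp continuous_subtype_val
        |>.subtype_mk fun y => y.2)).congr fun y => (g₂ _ y.2).symm
  rw [← continuousOn_univ]
  exact key.mono fun y _ => y.2

/-- A closed subset `S` of `T` such that `T × {0} ∪ S × I` is a retract of `T × I`. -/
def IsCofib {T : Type*} [TopologicalSpace T] (S : Set T) : Prop :=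
  IsClosed S ∧ ∃ r : C(T × I, T × I), (∀ y, (r y).2 = 0 ∨ (r y).1 ∈ S) ∧
    ∀ y : T × I, y.2 = 0 ∨ y.1 ∈ S → r y = y

/-- A subset `C` of `Y` that is a strong deformation retract of `Y`, where the deformation from
the retraction to the identity has reached `y` at time `φ y`. -/
def IsTrivCofib {Y : Type*} [TopologicalSpace Y] (C : Set Y) : Prop :=
  ∃ (D : C(Y × I, Y)) (φ : C(Y, I)), (∀ y, D (y, 0) ∈ C) ∧ (∀ y ∈ C, ∀ s, D (y, s) = y) ∧
    (∀ y, D (y, φ y) = y) ∧ ∀ y ∈ C, φ y = 0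

/-- The homotopy lifting property of `q` for the space `Y`. -/
def HasHLP (Y : Type*) [TopologicalSpace Y] {U V : Type*} [TopologicalSpace U] [TopologicalSpace V]
    (q : C(U, V)) : Prop :=
  ∀ (H : C(Y × I, V)) (f : C(Y, U)), (∀ y, q (f y) = H (y, 0)) →
    ∃ G : C(Y × I, U), (∀ y, G (y, 0) = f y) ∧ ∀ y, q (G y) = H y

variable {T T' Y Z U V : Type*} [TopologicalSpace T] [TopologicalSpace T'] [TopologicalSpace Y]
  [TopologicalSpace Z] [TopologicalSpace U] [TopologicalSpace V] {S : Set T} {C : Set Y}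

/-- Lift the homotopy `f ∘ D` starting from `g ∘ D (·, 0)` and evaluate the lift at time `φ y`, when
the deformation has arrived at `y`. -/
theorem IsTrivCofib.exists_lift (hC : IsTrivCofib C) {q : C(U, V)} (hq : HasHLP Y q) (g : C(C, U))
    (f : C(Y, V)) (hg : ∀ y : C, q (g y) = f y) :
    ∃ k : C(Y, U), (∀ y : C, k y = g y) ∧ ∀ y, q (k y) = f y := by
  obtain ⟨D, φ, hD0, hDC, hDφ, hφ⟩ := hC
  obtain ⟨G, hG0, hG⟩ := hq (f.comp D)
    (g.comp ⟨fun y => ⟨D (y, 0), hD0 y⟩, by fun_prop⟩) fun y => hg ⟨D (y, 0), hD0 y⟩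
  refine ⟨⟨fun y => G (y, φ y), by fun_prop⟩, fun y => ?_, fun y => ?_⟩
  · change G (y.1, φ y.1) = g y
    rw [hφ y.1 y.2, hG0]
    exact congrArg g (Subtype.ext (hDC y.1 y.2 0))
  · change q (G (y, φ y)) = f y
    rw [hG]
    exact congrArg f (hDφ y)

theorem IsTrivCofib.prod_left (hC : IsTrivCofib C) (Z : Type*) [TopologicalSpace Z] :
    IsTrivCofib {y : Z × Y | y.2 ∈ C} := by
  obtain ⟨D, φ, hD0, hDC, hDφ, hφ⟩ := hC
  exact ⟨⟨fun y => (y.1.1, D (y.1.2, y.2)), by fun_prop⟩, ⟨fun y => φ y.2, by fun_prop⟩,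
    fun y => hD0 y.2, fun y hy s => Prod.ext rfl (hDC y.2 hy s), fun y => Prod.ext rfl (hDφ y.2),
    fun y hy => hφ y.2 hy⟩

theorem isClosed_zero_or_mem (hS : IsClosed S) : IsClosed {y : T × I | y.2 = 0 ∨ y.1 ∈ S} :=
  (isClosed_eq continuous_snd continuous_const).union (hS.preimage continuous_fst)

theorem exists_glue_zero_or_mem (hS : IsClosed S) (f : C(T, Z)) (k : C(S × I, Z))
    (h : ∀ s : S, k (s, 0) = f s) :
    ∃ g : C({y : T × I | y.2 = 0 ∨ y.1 ∈ S}, Z), (∀ t, g ⟨(t, 0), Or.inl rfl⟩ = f t) ∧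
      ∀ (s : S) (t : I), g ⟨(s, t), Or.inr s.2⟩ = k (s, t) := by
  obtain ⟨g, h₁, h₂⟩ := exists_glue (C₁ := {y : T × I | y.2 = 0}) (C₂ := {y : T × I | y.1 ∈ S})
    (isClosed_eq continuous_snd continuous_const) (hS.preimage continuous_fst)
    ⟨fun y => f y.1.1, by fun_prop⟩ ⟨fun y => k (⟨y.1.1, y.2⟩, y.1.2), by fun_prop⟩ (by
      rintro ⟨t, s⟩ (rfl : s = 0) b
      exact (h ⟨t, b⟩).symm)
  exact ⟨g, fun t => h₁ _ rfl, fun s t => h₂ (s.1, t) s.2⟩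

theorem IsCofib.exists_extension (hS : IsCofib S) (f : C(T, Z)) (k : C(S × I, Z))
    (h : ∀ s : S, k (s, 0) = f s) :
    ∃ G : C(T × I, Z), (∀ t, G (t, 0) = f t) ∧ ∀ (s : S) (t : I), G (s, t) = k (s, t) := by
  obtain ⟨hcl, r, hr, hr'⟩ := hS
  obtain ⟨g, g₁, g₂⟩ := exists_glue_zero_or_mem hcl f k h
  refine ⟨g.comp ⟨fun y => ⟨r y, hr y⟩, by fun_prop⟩, fun t => ?_, fun s t => ?_⟩
  · rw [← g₁ t]
    exact congrArg g (Subtype.ext (hr' (t, 0) (Or.inl rfl)))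
  · rw [← g₂ s t]
    exact congrArg g (Subtype.ext (hr' (s.1, t) (Or.inr s.2)))

theorem IsCofib.prod_right (hS : IsCofib S) (Y : Type*) [TopologicalSpace Y] :
    IsCofib {y : T × Y | y.1 ∈ S} := by
  obtain ⟨hcl, r, hr, hr'⟩ := hS
  refine ⟨hcl.preimage continuous_fst,
    ⟨fun y => (((r (y.1.1, y.2)).1, y.1.2), (r (y.1.1, y.2)).2), by fun_prop⟩,
    fun y => hr (y.1.1, y.2), fun y hy => ?_⟩
  have := hr' (y.1.1, y.2) hy
  simp [this]

/-- A pair which is a retract of a cofibration is a cofibration. -/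
theorem IsCofib.of_retract {S' : Set T'} (hS' : IsCofib S') (i : C(T, T')) (j : C(T', T))
    (hij : ∀ t, j (i t) = t) (hi : Set.MapsTo i S S') (hj : Set.MapsTo j S' S) : IsCofib S := by
  obtain ⟨hcl, r, hr, hr'⟩ := hS'
  have hSi : S = i ⁻¹' S' := Set.Subset.antisymm hi fun t ht => hij t ▸ hj ht
  refine ⟨hSi ▸ hcl.preimage i.continuous,
    ⟨fun y => (j (r (i y.1, y.2)).1, (r (i y.1, y.2)).2), by fun_prop⟩,
    fun y => (hr (i y.1, y.2)).imp id fun h => hj h, fun y hy => ?_⟩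
  have := hr' (i y.1, y.2) (hy.imp id fun h => hi h)
  simp [this, hij]

/-- The deformation used to lift along fibrations relative to a cofibration. -/
theorem IsTrivCofib.of_deformation {D : C(Y × I, Y)} {φ : C(Y, I)} (hD0 : ∀ y, D (y, 0) ∈ C)
    (hD1 : ∀ y, D (y, 1) = y) (hDC : ∀ y ∈ C, ∀ s, D (y, s) = y) (hφ : ∀ y, φ y = 0 ↔ y ∈ C) :
    IsTrivCofib C := by
  -- Strøm's reparametrization: the deformation runs at speed `1 / φ y`, so that it ends at time `φ
  -- y`. Where `φ y = 0` the quotient is `0` by convention, but any value would do, since `D` is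
  -- stationary there.
  let e : Y × I → I := fun y => Set.projIcc 0 1 zero_le_one ((y.2 : ℝ) / φ y.1)
  have he : ∀ y : Y × I, φ y.1 ≠ 0 → ContinuousAt e y := fun y hy => by
    refine continuous_projIcc.continuousAt.comp (ContinuousAt.div (by fun_prop) (by fun_prop) ?_)
    exact fun h => hy (Subtype.ext h)
  refine ⟨⟨fun y => D (y.1, e y), continuous_iff_continuousAt.2 fun y => ?_⟩, φ, fun y => ?_,
    fun y hy s => hDC y hy _, fun y => ?_, fun y hy => (hφ y).2 hy⟩
  · by_cases hy : φ y.1 = 0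
    -- Here `e` may be discontinuous. As `D` fixes `y.1` at all times, compactness of `I` keeps `D
    -- (z, s)` in `W` for all `s` at once when `z` is near `y.1`.
    · have hyC := (hφ y.1).1 hy
      intro W hW
      have hW' : W ∈ 𝓝 y.1 := by simpa only [hDC y.1 hyC] using hW
      have h2 := isCompact_univ.eventually_forall_of_forall_eventually
        (P := fun (z : Y) (s : I) => D (z, s) ∈ W) (x₀ := y.1) fun s hs => by
          have : ContinuousAt (fun z : Y × I => D z) (y.1, s) := by fun_prop
          refine this ?_
          simpa only [hDC y.1 hyC] using hW'
      exact (continuous_fst.tendsto y).eventually h2 |>.mono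
        fun z hz => hz (e z) trivial
    · have : ContinuousAt (fun z : Y × I => (z.1, e z)) y := continuousAt_fst.prodMk (he y hy)
      exact D.continuous.continuousAt.comp this
  · have : e (y, 0) = 0 := by simp [e]
    simpa [this] using hD0 y
  · by_cases hy : φ y = 0
    · exact hDC y ((hφ y).1 hy) _
    · have : e (y, φ y) = 1 := by
        have hy' : (φ y : ℝ) ≠ 0 := fun h => hy (Subtype.ext h)
        simp [e, div_self hy']
      simp [this, hD1]

/-- The deformation shrinks the time fed to `r` in the first coordinate and interpolates linearly in
the second. The function `φ (x, t)` is the largest discrepancy between a time in `[0, t]` and the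
second coordinate of `r` at `x` and that time. -/
theorem IsCofib.isTrivCofib (hS : IsCofib S) : IsTrivCofib {y : T × I | y.2 = 0 ∨ y.1 ∈ S} := by
  obtain ⟨hcl, r, hr, hr'⟩ := hS
  let F : C(T × I, C(I, ℝ)) := ContinuousMap.curry
    ⟨fun z : (T × I) × I => (z.1.2 * z.2 : I) - ((r (z.1.1, z.1.2 * z.2)).2 : ℝ), by fun_prop⟩
  have hF : ∀ y s, F y s = (y.2 * s : I) - ((r (y.1, y.2 * s)).2 : ℝ) := fun _ _ => rfl
  have hF1 : ∀ y, ‖F y‖ ≤ 1 := fun y => by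
    refine (ContinuousMap.norm_le _ zero_le_one).2 fun s => ?_
    rw [hF, Real.norm_eq_abs, abs_le]
    have h1 := (y.2 * s).2
    have h2 := (r (y.1, y.2 * s)).2.2
    constructor <;> linarith [h1.1, h1.2, h2.1, h2.2]
  let D : C((T × I) × I, T × I) :=
    ⟨fun z => ((r (z.1.1, z.1.2 * σ z.2)).1,
      Set.projIcc 0 1 zero_le_one ((z.2 : ℝ) * z.1.2 + (1 - z.2) * (r z.1).2)), by
        refine Continuous.prodMk (by fun_prop) (continuous_projIcc.comp (by fun_prop))⟩
  have hD : ∀ y s, D (y, s) = ((r (y.1, y.2 * σ s)).1,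
      Set.projIcc 0 1 zero_le_one ((s : ℝ) * y.2 + (1 - s) * (r y).2)) := fun _ _ => rfl
  refine IsTrivCofib.of_deformation (D := D)
    (φ := ⟨fun y => ⟨‖F y‖, norm_nonneg _, hF1 y⟩, by fun_prop⟩) ?_ ?_ ?_ ?_
  · intro y
    have : D (y, 0) = r y := by simp [hD]
    rw [this]
    exact hr y
  · intro y
    have h0 := hr' (y.1, 0) (Or.inl rfl)
    simp [hD, h0]
  · intro y hy s
    have h0 := hr' y hy
    have h1 := hr' (y.1, y.2 * σ s) (hy.imp (fun h => by simp [h]) id)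
    have h2 : (s : ℝ) * y.2 + (1 - s) * y.2 = y.2 := by ring
    simp [hD, h0, h1, h2]
  · intro y
    change (⟨‖F y‖, _⟩ : I) = 0 ↔ _
    rw [Subtype.ext_iff]
    change ‖F y‖ = 0 ↔ _
    rw [norm_eq_zero]
    constructor
    · intro h
      have h1 : ∀ s, ((y.2 * s : I) : ℝ) = (r (y.1, y.2 * s)).2 := fun s => by
        have := congrArg (fun G : C(I, ℝ) => G s) h
        simp only [hF, ContinuousMap.zero_apply] at this
        linarith
      by_cases hy : y.2 = 0
      · exact Or.inl hy
      · right
        -- At positive times `r` does not land in the bottom, hence it lands over `S`. Letting `s`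
        -- tend to `0`, where `r` is the identity, puts `y.1` in the closed set `S`.
        have h2 : ∀ s ∈ Set.Ioc (0 : I) 1, (r (y.1, y.2 * s)).1 ∈ S := fun s hs =>
          (hr (y.1, y.2 * s)).resolve_left fun h3 => by
            have h4 := h1 s
            rw [h3] at h4
            have h5 : y.2 * s = 0 := Subtype.ext h4
            rcases mul_eq_zero.1 h5 with h6 | h6
            · exact hy h6
            · exact hs.1.ne' h6
        have h3 : (0 : I) ∈ closure (Set.Ioc (0 : I) 1) := by
          rw [closure_Ioc (by simp)]
          simp
        have h4 : Set.MapsTo (fun s => (r (y.1, y.2 * s)).1) (closure (Set.Ioc (0 : I) 1))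
            (closure S) := Set.MapsTo.closure h2 (by fun_prop)
        have h5 := h4 h3
        rw [hcl.closure_eq] at h5
        simpa [hr' (y.1, 0) (Or.inl rfl)] using h5
    · intro hy
      ext s
      rw [hF, hr' (y.1, y.2 * s) (hy.imp (fun h => by simp [h]) id)]
      simp

/-- The homotopy lifting property relative to a cofibration. -/
theorem IsCofib.exists_lift_homotopy (hS : IsCofib S) {q : C(U, V)} (hq : HasHLP (T × I) q)
    (H : C(T × I, V)) (f : C(T, U)) (k : C(S × I, U)) (hkf : ∀ s : S, k (s, 0) = f s)
    (hf : ∀ t, q (f t) = H (t, 0)) (hk : ∀ (s : S) (t : I), q (k (s, t)) = H (s, t)) :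
    ∃ G : C(T × I, U), (∀ t, G (t, 0) = f t) ∧ (∀ (s : S) (t : I), G (s, t) = k (s, t)) ∧
      ∀ y, q (G y) = H y := by
  obtain ⟨g, g₁, g₂⟩ := exists_glue_zero_or_mem hS.1 f k hkf
  obtain ⟨G, hG, hGH⟩ := hS.isTrivCofib.exists_lift hq g H (by
    rintro ⟨⟨t, s⟩, hs | ht⟩
    · obtain rfl : s = 0 := hs
      exact (congrArg q (g₁ t)).trans (hf t)
    · exact (congrArg q (g₂ ⟨t, ht⟩ s)).trans (hk ⟨t, ht⟩ s))
  exact ⟨G, fun t => (hG ⟨(t, 0), Or.inl rfl⟩).trans (g₁ t),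
    fun s t => (hG ⟨(s.1, t), Or.inr s.2⟩).trans (g₂ s t), hGH⟩

/-- Extension from the pushout product of a cofibration and a trivial cofibration. -/
theorem IsCofib.exists_extension_prod (hS : IsCofib S) (hC : IsTrivCofib C)
    (g : C({y : T × Y | y.2 ∈ C ∨ y.1 ∈ S}, Z)) : ∃ G : C(T × Y, Z), ∀ y, G y.1 = g y := by
  obtain ⟨D, φ, hD0, hDC, hDφ, hφ⟩ := hC
  -- Extend `g (t, D (y, s))` from `S × Y × I` and the bottom to `T × Y × I`; the extension is then
  -- evaluated at time `φ y`.
  obtain ⟨G, hG0, hG⟩ := (hS.prod_right Y).exists_extension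
    (g.comp ⟨fun y => ⟨(y.1, D (y.2, 0)), Or.inl (hD0 y.2)⟩, by fun_prop⟩)
    (g.comp ⟨fun y => ⟨(y.1.1.1, D (y.1.1.2, y.2)), Or.inr y.1.2⟩, by fun_prop⟩) fun y => rfl
  refine ⟨⟨fun y => G (y, φ y.2), by fun_prop⟩, ?_⟩
  rintro ⟨⟨t, y⟩, h | h⟩
  · change G ((t, y), φ y) = _
    rw [hφ y h, hG0]
    exact congrArg g (Subtype.ext (Prod.ext rfl (hDC y h 0)))
  · refine (hG ⟨(t, y), h⟩ (φ y)).trans ?_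
    exact congrArg g (Subtype.ext (Prod.ext rfl (hDφ y)))

/-- The unit sphere in the closed unit ball is a cofibration. -/
theorem isCofib_sphere (V : Type*) [NormedAddCommGroup V] [NormedSpace ℝ V] :
    IsCofib {x : Metric.closedBall (0 : V) 1 | ‖x.1‖ = 1} := by
  -- The retraction of the cylinder onto floor and wall is central projection from the point at
  -- height `2` on the axis, with scaling factor `1 / M`. The two terms of the maximum correspond to
  -- hitting the wall and hitting the floor.
  let M : Metric.closedBall (0 : V) 1 × I → ℝ := fun y => max ‖y.1.1‖ (1 - y.2 / 2)
  have hMc : Continuous M := by fun_prop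
  have hM : ∀ y, 1 / 2 ≤ M y := fun y => le_max_of_le_right (by linarith [y.2.2.2])
  have hM0 : ∀ y, 0 < M y := fun y => lt_of_lt_of_le (by norm_num) (hM y)
  have hx : ∀ x : Metric.closedBall (0 : V) 1, ‖x.1‖ ≤ 1 := fun x =>
    mem_closedBall_zero_iff.1 x.2
  have h1 : ∀ y, ‖(M y)⁻¹ • y.1.1‖ = (M y)⁻¹ * ‖y.1.1‖ := fun y => by
    rw [norm_smul, norm_inv, Real.norm_of_nonneg (hM0 y).le]
  refine ⟨isClosed_eq (by fun_prop) (by fun_prop),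
    ⟨fun y => (⟨(M y)⁻¹ • y.1.1, ?_⟩, ⟨2 - (2 - y.2) * (M y)⁻¹, ?_, ?_⟩), ?_⟩, ?_, ?_⟩
  · rw [mem_closedBall_zero_iff, h1, inv_mul_le_one₀ (hM0 y)]
    exact le_max_left _ _
  · have : (2 - (y.2 : ℝ)) * (M y)⁻¹ ≤ 2 := by
      rw [mul_inv_le_iff₀ (hM0 y)]
      linarith [le_max_right ‖y.1.1‖ (1 - (y.2 : ℝ) / 2)]
    linarith
  · have : 1 ≤ (2 - (y.2 : ℝ)) * (M y)⁻¹ := by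
      rw [le_mul_inv_iff₀ (hM0 y), one_mul]
      exact max_le (by linarith [hx y.1, y.2.2.2]) (by linarith [y.2.2.2])
    linarith
  · have : Continuous fun y => (M y)⁻¹ := hMc.inv₀ fun y => (hM0 y).ne'
    fun_prop
  · intro y
    rcases le_total ‖y.1.1‖ (1 - (y.2 : ℝ) / 2) with h | h
    · left
      have hMy : M y = 1 - (y.2 : ℝ) / 2 := max_eq_right h
      have h3 : (M y) ≠ 0 := (hM0 y).ne'
      refine Subtype.ext ?_
      change 2 - (2 - (y.2 : ℝ)) * (M y)⁻¹ = 0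
      field_simp
      rw [hMy]
      ring
    · right
      have hMy : M y = ‖y.1.1‖ := max_eq_left h
      change ‖(M y)⁻¹ • y.1.1‖ = 1
      rw [h1, hMy, inv_mul_cancel₀]
      exact hMy ▸ (hM0 y).ne'
  · intro y hy
    have hMy : M y = 1 := by
      rcases hy with h | h
      · have : M y = max ‖y.1.1‖ 1 := by simp [M, h]
        rw [this, max_eq_right (hx _)]
      · have h' : ‖y.1.1‖ = 1 := h
        have : M y = max 1 (1 - (y.2 : ℝ) / 2) := by simp [M, h']
        rw [this, max_eq_left (by linarith [y.2.2.1])]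
    refine Prod.ext (Subtype.ext ?_) (Subtype.ext ?_)
    · change (M y)⁻¹ • y.1.1 = y.1.1
      simp [hMy]
    · change 2 - (2 - (y.2 : ℝ)) * (M y)⁻¹ = y.2
      rw [hMy]
      ring

/-- The cube is the unit ball of the sup norm up to the affine change `x ↦ 2x - 1`, which carries
the boundary to the unit sphere. -/
theorem isCofib_boundary_cube (n : ℕ) : IsCofib (Cube.boundary (Fin n)) := by
  have hi : ∀ x : I, ‖2 * (x : ℝ) - 1‖ ≤ 1 := fun x => by
    rw [Real.norm_eq_abs, abs_le]
    constructor <;> linarith [x.2.1, x.2.2]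
  have hm : ∀ x : Fin n → I, (fun i => 2 * (x i : ℝ) - 1) ∈ Metric.closedBall (0 : Fin n → ℝ) 1 :=
    fun x => mem_closedBall_zero_iff.2
      ((pi_norm_le_iff_of_nonneg zero_le_one).2 fun i => hi (x i))
  refine (isCofib_sphere (Fin n → ℝ)).of_retract
    ⟨fun x => ⟨fun i => 2 * (x i : ℝ) - 1, hm x⟩, Continuous.subtype_mk (by fun_prop) hm⟩
    ⟨fun y i => Set.projIcc 0 1 zero_le_one ((y.1 i + 1) / 2), ?_⟩ ?_ ?_ ?_
  · exact continuous_pi fun i => continuous_projIcc.comp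
      ((((continuous_apply i).comp continuous_subtype_val).add continuous_const).div_const 2)
  · intro x
    funext i
    change Set.projIcc 0 1 zero_le_one ((2 * (x i : ℝ) - 1 + 1) / 2) = x i
    have : (2 * (x i : ℝ) - 1 + 1) / 2 = x i := by ring
    rw [this, Set.projIcc_val]
  · rintro x ⟨i, hxi⟩
    refine le_antisymm (mem_closedBall_zero_iff.1 (hm x)) ?_
    refine le_trans ?_ (norm_le_pi_norm (fun i => 2 * (x i : ℝ) - 1) i)
    rcases hxi with h | h <;> (simp [h]; try norm_num)
  · intro y hy
    by_contra hb
    have hy1 : ‖y.1‖ = 1 := hy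
    have hyle : ∀ i, ‖y.1 i‖ ≤ 1 := fun i => (norm_le_pi_norm y.1 i).trans hy1.le
    have h1 : ∀ i, ‖y.1 i‖ < 1 := fun i => by
      refine lt_of_le_of_ne (hyle i) fun h => hb ⟨i, ?_⟩
      rw [Real.norm_eq_abs] at h
      rcases (abs_eq zero_le_one).1 h with h | h
      · right
        simp [h]
      · left
        simp [h]
    exact ((pi_norm_lt_iff zero_lt_one).2 h1).ne hy1

theorem isCofib_endpoints : IsCofib ({t | t = 0 ∨ t = 1} : Set I) :=
  (isCofib_boundary_cube 1).of_retract ⟨fun t _ => t, by fun_prop⟩ ⟨fun x => x 0, by fun_prop⟩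
    (fun _ => rfl) (fun _ ht => ⟨0, ht⟩) (by
      rintro x ⟨i, hi⟩
      rwa [Subsingleton.elim i 0] at hi)

/-- The product of a cofibration with the pair `(I, {0, 1})` is a cofibration. -/
theorem IsCofib.prod_interval (hS : IsCofib S) :
    IsCofib {y : T × I | (y.2 = 0 ∨ y.2 = 1) ∨ y.1 ∈ S} := by
  let Q : Set ((T × I) × I) := {z | z.2 = 0 ∨ (z.1.2 = 0 ∨ z.1.2 = 1) ∨ z.1.1 ∈ S}
  -- Extending the identity of `Q` over `T × I × I` yields the required retraction.
  obtain ⟨G, hG⟩ := hS.exists_extension_prod isCofib_endpoints.isTrivCofib (Z := Q)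
    ⟨fun y => ⟨((y.1.1, y.1.2.1), y.1.2.2), or_assoc.1 y.2⟩, by fun_prop⟩
  refine ⟨?_, ⟨fun z => (G (z.1.1, (z.1.2, z.2))).1, by fun_prop⟩,
    fun z => (G (z.1.1, (z.1.2, z.2))).2, fun z hz => ?_⟩
  · exact ((isClosed_eq continuous_snd continuous_const).union
      (isClosed_eq continuous_snd continuous_const)).union (hS.1.preimage continuous_fst)
  · have := hG ⟨(z.1.1, (z.1.2, z.2)), or_assoc.2 hz⟩
    exact congrArg Subtype.val this

end Cofibrations

/-! ### Direct systems of spaces and weak colimits -/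

section Homotopies

variable {T Z U : Type*} [TopologicalSpace T] [TopologicalSpace Z] [TopologicalSpace U] {S : Set T}

theorem homotopicRel_iff {f g : C(T, U)} : f.HomotopicRel g S ↔
    ∃ G : C(T × I, U), (∀ t, G (t, 0) = f t) ∧ (∀ t, G (t, 1) = g t) ∧
      ∀ s ∈ S, ∀ r, G (s, r) = f s := by
  constructor
  · rintro ⟨H⟩
    exact ⟨⟨fun y => H (y.2, y.1), by fun_prop⟩, fun t => H.apply_zero t, fun t => H.apply_one t,
      fun s hs r => H.eq_fst r hs⟩
  · rintro ⟨G, h0, h1, hS⟩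
    exact ⟨⟨⟨⟨fun y => G (y.2, y.1), by fun_prop⟩, h0, h1⟩, fun r s hs => hS s hs r⟩⟩

theorem exists_glue_endpoints (hS : IsClosed S) (f₀ f₁ : C(T, Z)) (h : ∀ s ∈ S, f₀ s = f₁ s) :
    ∃ g : C({y : T × I | (y.2 = 0 ∨ y.2 = 1) ∨ y.1 ∈ S}, Z),
      (∀ t, g ⟨(t, 0), Or.inl (Or.inl rfl)⟩ = f₀ t) ∧
      (∀ t, g ⟨(t, 1), Or.inl (Or.inr rfl)⟩ = f₁ t) ∧
      ∀ (t : T) (ht : t ∈ S) (r : I), g ⟨(t, r), Or.inr ht⟩ = f₀ t := by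
  obtain ⟨g, h₁, h₂⟩ := exists_glue (C₁ := {y : T × I | y.2 = 0 ∨ y.1 ∈ S})
    (C₂ := {y : T × I | y.2 = 1}) (isClosed_zero_or_mem hS)
    (isClosed_eq continuous_snd continuous_const)
    ⟨fun y => f₀ y.1.1, by fun_prop⟩ ⟨fun y => f₁ y.1.1, by fun_prop⟩ (by
      rintro ⟨t, r⟩ (hr | ht) (rfl : r = 1)
      · exact absurd hr (by simp)
      · exact h t ht)
  have hmem : ∀ y : {y : T × I | (y.2 = 0 ∨ y.2 = 1) ∨ y.1 ∈ S},
      (y.1.2 = 0 ∨ y.1.1 ∈ S) ∨ y.1.2 = 1 := fun y => by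
    rcases y.2 with (h | h) | h
    exacts [Or.inl (Or.inl h), Or.inr h, Or.inl (Or.inr h)]
  exact ⟨g.comp ⟨fun y => ⟨y.1, hmem y⟩, continuous_subtype_val.subtype_mk _⟩,
    fun t => h₁ (t, 0) (Or.inl rfl),
    fun t => h₂ (t, 1) rfl, fun t ht r => h₁ (t, r) (Or.inr ht)⟩

/-- Gluing is done for the curried maps into the path space `C(I, Z)`, which reduces it to
`exists_glue_endpoints`. The result prescribes a homotopy on the two ends of `T × I` and on `S × I`.
-/
theorem exists_glue_faces (hS : IsClosed S) (f₀ f₁ : C(T × I, Z))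
    (h : ∀ s ∈ S, ∀ r, f₀ (s, r) = f₁ (s, r)) :
    ∃ k : C({y : T × I | (y.2 = 0 ∨ y.2 = 1) ∨ y.1 ∈ S} × I, Z),
      (∀ t r, k (⟨(t, 0), Or.inl (Or.inl rfl)⟩, r) = f₀ (t, r)) ∧
      (∀ t r, k (⟨(t, 1), Or.inl (Or.inr rfl)⟩, r) = f₁ (t, r)) ∧
      ∀ (t : T) (ht : t ∈ S) (b r : I), k (⟨(t, b), Or.inr ht⟩, r) = f₀ (t, r) := by
  obtain ⟨g, g₀, g₁, gS⟩ := exists_glue_endpoints hS f₀.curry f₁.curry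
    fun s hs => ContinuousMap.ext fun r => h s hs r
  exact ⟨g.uncurry, fun t r => congrArg (fun c : C(I, Z) => c r) (g₀ t),
    fun t r => congrArg (fun c : C(I, Z) => c r) (g₁ t),
    fun t ht b r => congrArg (fun c : C(I, Z) => c r) (gS t ht b)⟩

end Homotopies

/-- A direct system of spaces together with a cocone on it. -/
structure IndSpace (ι : Type w) [Preorder ι] where
  U : ι → Type u
  [top : ∀ i, TopologicalSpace (U i)]
  L : Type u
  [topL : TopologicalSpace L]
  tr : ∀ {i j : ι}, i ≤ j → C(U i, U j)
  toL : ∀ i, C(U i, L)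
  tr_tr : ∀ {i j k : ι} (hij : i ≤ j) (hjk : j ≤ k) (x : U i),
    tr hjk (tr hij x) = tr (hij.trans hjk) x
  toL_tr : ∀ {i j : ι} (hij : i ≤ j) (x : U i), toL j (tr hij x) = toL i x

attribute [instance] IndSpace.top IndSpace.topL

namespace IndSpace

variable {ι : Type w} [Preorder ι]

/-- The cocone point of a direct system of spaces is weakly equivalent to its colimit, as seen by
compact Hausdorff relative test objects. -/
def IsWeakColimit (𝒰 : IndSpace.{u, w} ι) : Prop :=
  ∀ (T : Type) [TopologicalSpace T] [CompactSpace T] [T2Space T] (S : Set T), IsCofib S →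
    ∀ (i : ι) (a : C(S, 𝒰.U i)) (v : C(T, 𝒰.L)), (∀ s : S, v s = 𝒰.toL i (a s)) →
      ∃ (j : ι) (h : i ≤ j) (c : C(T, 𝒰.U j)), (∀ s : S, c s = 𝒰.tr h (a s)) ∧
        ((𝒰.toL j).comp c).HomotopicRel v S

/-- A morphism of direct systems of spaces with cocones. -/
structure Hom (𝒰 : IndSpace.{u, w} ι) (𝒱 : IndSpace.{v, w} ι) where
  f : ∀ i, C(𝒰.U i, 𝒱.U i)
  fL : C(𝒰.L, 𝒱.L)
  tr_f : ∀ {i j : ι} (h : i ≤ j) (x : 𝒰.U i), 𝒱.tr h (f i x) = f j (𝒰.tr h x)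
  toL_f : ∀ (i : ι) (x : 𝒰.U i), 𝒱.toL i (f i x) = fL (𝒰.toL i x)

variable {𝒰 𝒱 𝒲 : IndSpace.{u, w} ι}

/-- The levelwise pullback of direct systems of spaces. -/
def pullback (b : Hom 𝒲 𝒱) (q : Hom 𝒰 𝒱) : IndSpace.{u, w} ι where
  U i := {y : 𝒲.U i × 𝒰.U i // b.f i y.1 = q.f i y.2}
  L := {y : 𝒲.L × 𝒰.L // b.fL y.1 = q.fL y.2}
  tr h := ⟨fun y => ⟨(𝒲.tr h y.1.1, 𝒰.tr h y.1.2), by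
    rw [← b.tr_f, ← q.tr_f, y.2]⟩, by fun_prop⟩
  toL i := ⟨fun y => ⟨(𝒲.toL i y.1.1, 𝒰.toL i y.1.2), by
    rw [← b.toL_f, ← q.toL_f, y.2]⟩, by fun_prop⟩
  tr_tr hij hjk y := Subtype.ext (Prod.ext (𝒲.tr_tr hij hjk _) (𝒰.tr_tr hij hjk _))
  toL_tr hij y := Subtype.ext (Prod.ext (𝒲.toL_tr hij _) (𝒰.toL_tr hij _))

/-- Weak colimits are stable under levelwise pullback along fibrations. -/
theorem IsWeakColimit.pullback (h𝒲 : 𝒲.IsWeakColimit) (h𝒰 : 𝒰.IsWeakColimit)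
    (h𝒱 : 𝒱.IsWeakColimit) (b : Hom 𝒲 𝒱) (q : Hom 𝒰 𝒱)
    (hq : ∀ (i : ι) (Y : Type) [TopologicalSpace Y] [CompactSpace Y] [T2Space Y],
      HasHLP Y (q.f i))
    (hqL : ∀ (Y : Type) [TopologicalSpace Y] [CompactSpace Y] [T2Space Y], HasHLP Y q.fL) :
    (pullback b q).IsWeakColimit := by
  intro T _ _ _ S hS i a v hav
  let aW : C(S, 𝒲.U i) := ⟨fun s => (a s).1.1, by fun_prop⟩
  let aU : C(S, 𝒰.U i) := ⟨fun s => (a s).1.2, by fun_prop⟩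
  let vW : C(T, 𝒲.L) := ⟨fun t => (v t).1.1, by fun_prop⟩
  let vU : C(T, 𝒰.L) := ⟨fun t => (v t).1.2, by fun_prop⟩
  have ha : ∀ s, b.f i (aW s) = q.f i (aU s) := fun s => (a s).2
  have hv : ∀ t, b.fL (vW t) = q.fL (vU t) := fun t => (v t).2
  have havW : ∀ s : S, vW s = 𝒲.toL i (aW s) := fun s => congrArg (fun y => y.1.1) (hav s)
  have havU : ∀ s : S, vU s = 𝒰.toL i (aU s) := fun s => congrArg (fun y => y.1.2) (hav s)
  -- Approximate the `𝒲`-component by `c`, then move the `𝒰`-component along the lift `M` of the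
  -- resulting homotopy, so that its end `u₁` lies over the image of `c` in the limit.
  obtain ⟨j, hij, c, hc, hcv⟩ := h𝒲 T S hS i aW vW havW
  obtain ⟨Ψ, Ψ0, Ψ1, ΨS⟩ := homotopicRel_iff.1 hcv.symm
  obtain ⟨M, M0, MS, hM⟩ := hS.exists_lift_homotopy (hqL (T × I)) (b.fL.comp Ψ) vU
    ⟨fun y => vU y.1, by fun_prop⟩ (fun s => rfl)
    (fun t => by rw [← hv, ContinuousMap.comp_apply, Ψ0])
    (fun s r => by
      rw [ContinuousMap.comp_apply, ΨS s s.2 r, hv]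
      rfl)
  let u₁ : C(T, 𝒰.L) := ⟨fun t => M (t, 1), by fun_prop⟩
  -- The approximation `d` of `u₁` need not lie over `c` at stage `k`; it does so only on `S`, and
  -- up to the homotopy `q.fL ∘ N` in the limit.
  obtain ⟨k, hjk, d, hd, hdu⟩ := h𝒰 T S hS j ((𝒰.tr hij).comp aU) u₁ (fun s => by
    change M (s, 1) = 𝒰.toL j (𝒰.tr hij (aU s))
    rw [MS, 𝒰.toL_tr, ← havU]
    rfl)
  obtain ⟨N, N0, N1, NS⟩ := homotopicRel_iff.1 hdu
  have hdS : ∀ s : S, q.f k (d s) = b.f k (𝒲.tr hjk (c s)) := fun s => by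
    rw [hd, hc, ContinuousMap.comp_apply, ← q.tr_f, ← q.tr_f, ← ha, b.tr_f, b.tr_f]
  obtain ⟨e, e0, e1, eS⟩ := exists_glue_endpoints hS.1 ((q.f k).comp d)
    ((b.f k).comp ((𝒲.tr hjk).comp c)) fun s hs => hdS ⟨s, hs⟩
  -- Approximate that homotopy, relative to its ends and to `S × I`, by a homotopy `ζ` at a finite
  -- stage from the image of `d` to the image of `c`.
  obtain ⟨l, hkl, ζ, hζ, hΘ⟩ := h𝒱 (T × I) _ hS.prod_interval k e (q.fL.comp N) (by
    rintro ⟨⟨t, r⟩, (hr | hr) | ht⟩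
    · obtain rfl : r = 0 := hr
      refine Eq.trans ?_ (congrArg _ (e0 t)).symm
      change q.fL (N (t, 0)) = 𝒱.toL k (q.f k (d t))
      rw [N0, q.toL_f]
      rfl
    · obtain rfl : r = 1 := hr
      refine Eq.trans ?_ (congrArg _ (e1 t)).symm
      change q.fL (N (t, 1)) = 𝒱.toL k (b.f k (𝒲.tr hjk (c t)))
      rw [N1, b.toL_f, 𝒲.toL_tr]
      refine (hM (t, 1)).trans ?_
      rw [ContinuousMap.comp_apply, Ψ1]
      rfl
    · refine Eq.trans ?_ (congrArg _ (eS t ht r)).symm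
      change q.fL (N (t, r)) = 𝒱.toL k (q.f k (d t))
      rw [NS t ht, q.toL_f]
      rfl)
  obtain ⟨Θ, Θ0, Θ1, ΘS⟩ := homotopicRel_iff.1 hΘ
  have ζ0 : ∀ t, ζ (t, 0) = 𝒱.tr hkl (q.f k (d t)) := fun t =>
    (hζ ⟨(t, 0), Or.inl (Or.inl rfl)⟩).trans (congrArg _ (e0 t))
  have ζ1 : ∀ t, ζ (t, 1) = 𝒱.tr hkl (b.f k (𝒲.tr hjk (c t))) := fun t =>
    (hζ ⟨(t, 1), Or.inl (Or.inr rfl)⟩).trans (congrArg _ (e1 t))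
  have ζS : ∀ s ∈ S, ∀ r, ζ (s, r) = 𝒱.tr hkl (q.f k (d s)) := fun s hs r =>
    (hζ ⟨(s, r), Or.inr hs⟩).trans (congrArg _ (eS s hs r))
  -- Lifting `ζ` from `d` corrects `d`: the end `Z (·, 1)` lies strictly over `c`.
  obtain ⟨Z, Z0, ZS, hZ⟩ := hS.exists_lift_homotopy (hq l (T × I)) ζ ((𝒰.tr hkl).comp d)
    ⟨fun y => 𝒰.tr hkl (d y.1), by fun_prop⟩ (fun s => rfl)
    (fun t => by rw [ζ0, q.tr_f]; rfl) (fun s r => by rw [ζS s s.2, q.tr_f]; rfl)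
  obtain ⟨κ, κ0, κ1, κS⟩ := exists_glue_faces hS.1 ((𝒰.toL l).comp Z) N (fun s hs r => by
    have := ZS ⟨s, hs⟩ r
    rw [ContinuousMap.comp_apply, this, NS s hs]
    exact 𝒰.toL_tr hkl (d s))
  have κS' : ∀ (t : T) (ht : t ∈ S) (b r : I), κ (⟨(t, b), Or.inr ht⟩, r) = 𝒰.toL k (d t) :=
    fun t ht b r => by
      rw [κS t ht b r, ContinuousMap.comp_apply, ZS ⟨t, ht⟩ r]
      exact 𝒰.toL_tr hkl (d t)
  -- Both `toL l ∘ Z` and `N` start at `toL k ∘ d`, and `Θ` joins their projections. Lift `Θ` with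
  -- the time of `Z` and `N` as lifting direction. At time `1` the base homotopy `Θ` is constant, so
  -- `Λ` ends in a homotopy within the fibres from `Z (·, 1)` to `u₁`.
  obtain ⟨Λ, -, ΛS, hΛ⟩ := hS.prod_interval.exists_lift_homotopy (hqL ((T × I) × I))
    ⟨fun y => Θ ((y.1.1, y.2), y.1.2), by fun_prop⟩ ⟨fun y => 𝒰.toL k (d y.1), by fun_prop⟩ κ (by
      rintro ⟨⟨t, r⟩, (hr | hr) | ht⟩
      · obtain rfl : r = 0 := hr
        refine (κ0 t 0).trans ?_
        rw [ContinuousMap.comp_apply, Z0]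
        exact 𝒰.toL_tr hkl (d t)
      · obtain rfl : r = 1 := hr
        exact (κ1 t 0).trans (N0 t)
      · exact κS' t ht r 0) (by
      rintro ⟨t, r⟩
      change q.fL (𝒰.toL k (d t)) = Θ ((t, 0), r)
      rw [ΘS _ (Or.inl (Or.inl rfl)) r, ContinuousMap.comp_apply, ζ0, 𝒱.toL_tr, q.toL_f]) (by
      rintro ⟨⟨t, b⟩, (hr | hr) | ht⟩ r
      · obtain rfl : b = 0 := hr
        refine (congrArg _ (κ0 t r)).trans ?_
        change q.fL (𝒰.toL l (Z (t, r))) = Θ ((t, r), 0)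
        rw [Θ0, ← q.toL_f, hZ]
        rfl
      · obtain rfl : b = 1 := hr
        refine (congrArg _ (κ1 t r)).trans ?_
        exact (Θ1 (t, r)).symm
      · refine (congrArg _ (κS' t ht b r)).trans ?_
        change q.fL (𝒰.toL k (d t)) = Θ ((t, r), b)
        rw [ΘS (t, r) (Or.inr ht) b, ContinuousMap.comp_apply, ζS t ht, 𝒱.toL_tr, q.toL_f])
  have hbw : ∀ t, b.fL (𝒲.toL j (c t)) = 𝒱.toL l (ζ (t, 1)) := fun t => by
    rw [ζ1, 𝒱.toL_tr, b.toL_f, 𝒲.toL_tr]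
  let c' : C(T, (IndSpace.pullback b q).U l) :=
    ⟨fun t => ⟨(𝒲.tr (hjk.trans hkl) (c t), Z (t, 1)), by
      rw [hZ, ζ1, b.tr_f, 𝒲.tr_tr]⟩, by fun_prop⟩
  let v' : C(T, (IndSpace.pullback b q).L) :=
    ⟨fun t => ⟨(𝒲.toL j (c t), M (t, 1)), by
      rw [hM, ContinuousMap.comp_apply, Ψ1]
      rfl⟩, by fun_prop⟩
  refine ⟨l, hij.trans (hjk.trans hkl), c', fun s => ?_, ?_⟩
  · refine Subtype.ext (Prod.ext ?_ ?_)
    · change 𝒲.tr (hjk.trans hkl) (c s) = 𝒲.tr _ (aW s)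
      rw [hc, 𝒲.tr_tr]
    · change Z (s, 1) = 𝒰.tr _ (aU s)
      rw [ZS s 1]
      change 𝒰.tr hkl (d s) = _
      rw [hd, ContinuousMap.comp_apply, 𝒰.tr_tr, 𝒰.tr_tr]
  · have hΛc : ∀ y : T × I, b.fL (𝒲.toL j (c y.1)) = q.fL (Λ ((y.1, y.2), 1)) := fun y => by
      rw [hΛ]
      change _ = Θ ((y.1, 1), y.2)
      rw [ΘS (y.1, 1) (Or.inl (Or.inr rfl)), hbw]
      rfl
    have h₁ : (((IndSpace.pullback b q).toL l).comp c').HomotopicRel v' S := by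
      refine homotopicRel_iff.2 ⟨⟨fun y => ⟨(𝒲.toL j (c y.1), Λ ((y.1, y.2), 1)), hΛc y⟩,
        Continuous.subtype_mk ((((𝒲.toL j).comp c).continuous.comp continuous_fst).prodMk
          (by fun_prop)) hΛc⟩, fun t => ?_, fun t => ?_, fun s hs r => ?_⟩
      · refine Subtype.ext (Prod.ext (𝒲.toL_tr (hjk.trans hkl) (c t)).symm ?_)
        exact (ΛS ⟨(t, 0), Or.inl (Or.inl rfl)⟩ 1).trans (κ0 t 1)
      · refine Subtype.ext (Prod.ext rfl ?_)
        exact ((ΛS ⟨(t, 1), Or.inl (Or.inr rfl)⟩ 1).trans (κ1 t 1)).trans (N1 t)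
      · refine Subtype.ext (Prod.ext (𝒲.toL_tr (hjk.trans hkl) (c s)).symm ?_)
        exact (ΛS ⟨(s, r), Or.inr hs⟩ 1).trans (κS s hs r 1)
    refine h₁.trans (ContinuousMap.HomotopicRel.symm (homotopicRel_iff.2
      ⟨⟨fun y => ⟨(Ψ y, M y), (hM y).symm⟩, by fun_prop⟩, fun t => ?_, fun t => ?_,
        fun s hs r => ?_⟩))
    · exact Subtype.ext (Prod.ext (Ψ0 t) (M0 t))
    · exact Subtype.ext (Prod.ext (Ψ1 t) rfl)
    · exact Subtype.ext (Prod.ext (ΨS s hs r) (MS ⟨s, hs⟩ r))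

/-- Weak colimits are stable under natural homotopy domination. -/
theorem IsWeakColimit.of_domination {𝒱 : IndSpace.{v, w} ι} (h𝒱 : 𝒱.IsWeakColimit)
    (f : Hom 𝒰 𝒱) (g : Hom 𝒱 𝒰)
    (h : ∀ i, C(𝒰.U i × I, 𝒰.U i)) (hL : C(𝒰.L × I, 𝒰.L))
    (h0 : ∀ i x, h i (x, 0) = g.f i (f.f i x)) (h1 : ∀ i x, h i (x, 1) = x)
    (hL0 : ∀ x, hL (x, 0) = g.fL (f.fL x)) (hL1 : ∀ x, hL (x, 1) = x)
    (toL_h : ∀ i x r, 𝒰.toL i (h i (x, r)) = hL (𝒰.toL i x, r)) : 𝒰.IsWeakColimit := by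
  intro T _ _ _ S hS i a v hav
  obtain ⟨j, hij, c, hc, hcv⟩ := h𝒱 T S hS i ((f.f i).comp a) (f.fL.comp v) fun s => by
    rw [ContinuousMap.comp_apply, hav, ContinuousMap.comp_apply, f.toL_f]
  obtain ⟨N, N0, N1, NS⟩ := homotopicRel_iff.1 hcv
  -- On `S` the map `g ∘ c` is only homotopic to `a`, through `h`; homotopy extension makes the
  -- agreement strict at time `1`.
  obtain ⟨G, G0, GS⟩ := hS.exists_extension ((g.f j).comp c)
    ⟨fun y => h j (𝒰.tr hij (a y.1), y.2), by fun_prop⟩ fun s => by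
      change h j (𝒰.tr hij (a s), 0) = g.f j (c s)
      rw [h0, hc, ContinuousMap.comp_apply, f.tr_f]
  have hG : ∀ s ∈ S, ∀ r, 𝒰.toL j (G (s, r)) = hL (v s, r) := fun s hs r => by
    rw [GS ⟨s, hs⟩ r]
    change 𝒰.toL j (h j (𝒰.tr hij (a ⟨s, hs⟩), r)) = _
    rw [toL_h, 𝒰.toL_tr, ← hav]
  obtain ⟨κ, κ0, κ1, κS⟩ := exists_glue_faces hS.1 ((𝒰.toL j).comp G)
    ⟨fun y => hL (v y.1, y.2), by fun_prop⟩ hG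
  -- Start from `g.fL ∘ N` and push its ends along `toL j ∘ G` and `hL`. At time `1` this joins the
  -- corrected map to `v`, and it is constant on `S`.
  obtain ⟨Λ, -, ΛS⟩ := hS.prod_interval.exists_extension (g.fL.comp N) κ (by
    rintro ⟨⟨t, r⟩, (hr | hr) | ht⟩
    · obtain rfl : r = 0 := hr
      refine (κ0 t 0).trans ?_
      rw [ContinuousMap.comp_apply, ContinuousMap.comp_apply, G0, N0]
      exact g.toL_f j (c t)
    · obtain rfl : r = 1 := hr
      refine (κ1 t 0).trans ?_
      rw [ContinuousMap.comp_apply, N1]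
      exact hL0 (v t)
    · refine (κS t ht r 0).trans ?_
      rw [ContinuousMap.comp_apply, hG t ht, ContinuousMap.comp_apply, NS t ht, hL0,
        ContinuousMap.comp_apply]
      have := hav ⟨t, ht⟩
      have h2 := hc ⟨t, ht⟩
      change v t = _ at this
      change c t = _ at h2
      rw [this, h2, 𝒱.toL_tr, ContinuousMap.comp_apply, f.toL_f])
  refine ⟨j, hij, ⟨fun t => G (t, 1), by fun_prop⟩, fun s => ?_, homotopicRel_iff.2
    ⟨⟨fun y => Λ (y, 1), by fun_prop⟩, fun t => ?_, fun t => ?_, fun s hs r => ?_⟩⟩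
  · exact (GS s 1).trans (h1 j _)
  · exact (ΛS ⟨(t, 0), Or.inl (Or.inl rfl)⟩ 1).trans (κ0 t 1)
  · exact ((ΛS ⟨(t, 1), Or.inl (Or.inr rfl)⟩ 1).trans (κ1 t 1)).trans (hL1 _)
  · exact (ΛS ⟨(s, r), Or.inr hs⟩ 1).trans (κS s hs r 1)

end IndSpace

/-! ### Continuity of mapping spaces in limits of compact Hausdorff spaces -/

/-- An inverse system of compact Hausdorff spaces together with its limit. -/
structure CompactLimit (ι : Type w) [Preorder ι] where
  X : ι → Type u
  [top : ∀ i, TopologicalSpace (X i)]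
  [compact : ∀ i, CompactSpace (X i)]
  [t2 : ∀ i, T2Space (X i)]
  Y : Type u
  [topY : TopologicalSpace Y]
  [compactY : CompactSpace Y]
  [t2Y : T2Space Y]
  p : ∀ {i j : ι}, i ≤ j → C(X j, X i)
  h : ∀ i, C(Y, X i)
  p_p : ∀ {i j k : ι} (hij : i ≤ j) (hjk : j ≤ k) (x : X k), p hij (p hjk x) = p (hij.trans hjk) x
  p_h : ∀ {i j : ι} (hij : i ≤ j) (y : Y), p hij (h j y) = h i y
  ext : ∀ y y' : Y, (∀ i, h i y = h i y') → y = y'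
  exists_lift : ∀ x : ∀ i, X i, (∀ (i j : ι) (hij : i ≤ j), p hij (x j) = x i) →
    ∃ y, ∀ i, h i y = x i

attribute [instance] CompactLimit.top CompactLimit.compact CompactLimit.t2 CompactLimit.topY
  CompactLimit.compactY CompactLimit.t2Y

namespace CompactLimit

variable {ι : Type w} [Preorder ι] (𝒳 : CompactLimit.{u, w} ι)

/-- The direct system of the spaces of maps into `K`. -/
def maps (K : Type v) [TopologicalSpace K] : IndSpace.{max u v, w} ι where
  U i := C(𝒳.X i, K)
  L := C(𝒳.Y, K)
  tr h := ⟨fun f => f.comp (𝒳.p h), ContinuousMap.continuous_precomp _⟩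
  toL i := ⟨fun f => f.comp (𝒳.h i), ContinuousMap.continuous_precomp _⟩
  tr_tr hij hjk f := ContinuousMap.ext fun x => congrArg f (𝒳.p_p hij hjk x)
  toL_tr hij f := ContinuousMap.ext fun y => congrArg f (𝒳.p_h hij y)

variable [IsDirectedOrder ι]

/-- Otherwise the families that avoid `W` at `i` and are compatible below `j` form a directed system
of nonempty compact sets. A common point is a point of the limit outside `W`. -/
theorem exists_range_subset {i : ι} {W : Set (𝒳.X i)} (hW : IsOpen W) (h : ∀ y, 𝒳.h i y ∈ W) :
    ∃ (j : ι) (hij : i ≤ j), ∀ x, 𝒳.p hij x ∈ W := by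
  by_contra! hne
  let Z : Set.Ici i → Set (∀ k, 𝒳.X k) := fun j =>
    {x | x i ∉ W ∧ ∀ (k : ι) (hk : k ≤ j.1), 𝒳.p hk (x j) = x k}
  have hne' : ∀ k, Nonempty (𝒳.X k) := fun k => by
    obtain ⟨j, hij, hkj⟩ := exists_ge_ge i k
    obtain ⟨x, -⟩ := hne j hij
    exact ⟨𝒳.p hkj x⟩
  have hcl : ∀ j, IsClosed (Z j) := fun j => by
    refine (hW.isClosed_compl.preimage (continuous_apply i)).inter ?_
    change IsClosed {x : ∀ k, 𝒳.X k | ∀ (k : ι) (hk : k ≤ j.1), 𝒳.p hk (x j) = x k}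
    simp only [Set.ofPred_forall]
    exact isClosed_iInter fun k => isClosed_iInter fun hk =>
      isClosed_eq ((𝒳.p hk).continuous.comp (continuous_apply _)) (continuous_apply k)
  have : Nonempty (Set.Ici i) := ⟨⟨i, le_refl i⟩⟩
  obtain ⟨x, hx⟩ := IsCompact.nonempty_iInter_of_directed_nonempty_isCompact_isClosed Z
    (fun j k => by
      obtain ⟨l, hj, hk⟩ := exists_ge_ge j.1 k.1
      refine ⟨⟨l, le_trans j.2 hj⟩, fun x hx => ⟨hx.1, fun n hn => ?_⟩,
        fun x hx => ⟨hx.1, fun n hn => ?_⟩⟩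
      · rw [← hx.2 j hj, 𝒳.p_p, ← hx.2 n (hn.trans hj)]
      · rw [← hx.2 k hk, 𝒳.p_p, ← hx.2 n (hn.trans hk)])
    (fun j => by
      classical
      obtain ⟨x, hx⟩ := hne j.1 j.2
      -- Coordinates at indices not below `j` are unconstrained and are filled in arbitrarily.
      refine ⟨fun k => if hk : k ≤ j.1 then 𝒳.p hk x else Classical.choice (hne' k), ?_, ?_⟩
      · have hij : i ≤ j.1 := j.2
        simpa [hij] using hx
      · intro k hk
        simp [hk, 𝒳.p_p])
    (fun j => (hcl j).isCompact) hcl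
  rw [Set.mem_iInter] at hx
  obtain ⟨y, hy⟩ := 𝒳.exists_lift x fun k l hkl => by
    obtain ⟨j, hij, hlj⟩ := exists_ge_ge i l
    have h1 := (hx ⟨j, hij⟩).2 l hlj
    have h2 := (hx ⟨j, hij⟩).2 k (hkl.trans hlj)
    rw [← h1, 𝒳.p_p, h2]
  exact (hx ⟨i, le_refl i⟩).1 (hy i ▸ h y)

/-- Compactness again: a triple violating the bound at every stage would have `y` and `y'` with
equal images in every `X k`, hence `y = y'`. -/
theorem exists_dist_lt {T V : Type*} [TopologicalSpace T] [CompactSpace T] [PseudoMetricSpace V]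
    (f : C(T × 𝒳.Y, V)) {ε : ℝ} (hε : 0 < ε) (i : ι) :
    ∃ j, i ≤ j ∧ ∀ t y y', 𝒳.h j y = 𝒳.h j y' → dist (f (t, y)) (f (t, y')) < ε := by
  by_contra! hne
  let Z : Set.Ici i → Set (T × 𝒳.Y × 𝒳.Y) := fun j =>
    {z | 𝒳.h j z.2.1 = 𝒳.h j z.2.2 ∧ ε ≤ dist (f (z.1, z.2.1)) (f (z.1, z.2.2))}
  have hcl : ∀ j, IsClosed (Z j) := fun j => by
    refine IsClosed.inter (s₁ := {z : T × 𝒳.Y × 𝒳.Y | 𝒳.h j z.2.1 = 𝒳.h j z.2.2})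
      (s₂ := {z : T × 𝒳.Y × 𝒳.Y | ε ≤ dist (f (z.1, z.2.1)) (f (z.1, z.2.2))})
      (isClosed_eq ?_ ?_) (isClosed_le ?_ ?_) <;> fun_prop
  have : Nonempty (Set.Ici i) := ⟨⟨i, le_refl i⟩⟩
  obtain ⟨z, hz⟩ := IsCompact.nonempty_iInter_of_directed_nonempty_isCompact_isClosed Z
    (fun j k => by
      obtain ⟨l, hj, hk⟩ := exists_ge_ge j.1 k.1
      refine ⟨⟨l, le_trans j.2 hj⟩, fun z hz => ⟨?_, hz.2⟩, fun z hz => ⟨?_, hz.2⟩⟩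
      · rw [← 𝒳.p_h hj, hz.1, 𝒳.p_h]
      · rw [← 𝒳.p_h hk, hz.1, 𝒳.p_h])
    (fun j => by
      obtain ⟨t, y, y', h1, h2⟩ := hne j.1 j.2
      exact ⟨(t, y, y'), h1, h2⟩)
    (fun j => (hcl j).isCompact) hcl
  rw [Set.mem_iInter] at hz
  have h1 : z.2.1 = z.2.2 := 𝒳.ext _ _ fun k => by
    obtain ⟨j, hij, hkj⟩ := exists_ge_ge i k
    rw [← 𝒳.p_h hkj, (hz ⟨j, hij⟩).1, 𝒳.p_h]
  have h2 := (hz ⟨i, le_refl i⟩).2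
  rw [h1, dist_self] at h2
  exact absurd h2 (not_le.2 hε)

/-- A map on `T × Y` can be approximated by a map on some `T × X k` which is prescribed on
`S × X k`. -/
theorem exists_approx {T V : Type*} [TopologicalSpace T] [CompactSpace T] [T2Space T]
    [NormedAddCommGroup V] [NormedSpace ℝ V] [FiniteDimensional ℝ V] {S : Set T} (hS : IsClosed S)
    {i : ι} (a : C(S × 𝒳.X i, V)) (f : C(T × 𝒳.Y, V))
    (haf : ∀ (s : S) y, f (s, y) = a (s, 𝒳.h i y)) {ε : ℝ} (hε : 0 < ε) :
    ∃ (k : ι) (hik : i ≤ k) (g : C(T × 𝒳.X k, V)), (∀ (s : S) x, g (s, x) = a (s, 𝒳.p hik x)) ∧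
      ∀ t y, dist (g (t, 𝒳.h k y)) (f (t, y)) < ε := by
  classical
  obtain ⟨k, hik, hk⟩ := 𝒳.exists_dist_lt f hε i
  have hS' : IsClosed {z : T × 𝒳.X k | z.1 ∈ S} := hS.preimage continuous_fst
  have : TietzeExtension.{_, _} V := TietzeExtension.of_tvs ℝ
  obtain ⟨e, he⟩ := ContinuousMap.exists_restrict_eq hS'
    (⟨fun z => a (⟨z.1.1, z.2⟩, 𝒳.p hik z.1.2), by fun_prop⟩ : C({z : T × 𝒳.X k | z.1 ∈ S}, V))
  have he' : ∀ (s : S) x, e (s, x) = a (s, 𝒳.p hik x) := fun s x =>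
    congrArg (fun c : C({z : T × 𝒳.X k | z.1 ∈ S}, V) => c ⟨(s.1, x), s.2⟩) he
  -- The estimate over a whole fibre of `h k` is an open condition, since the set of violations is
  -- compact and so is its image in `T × X k`.
  have near : ∀ (g : C(T × 𝒳.X k, V)) (z : T × 𝒳.X k),
      (∀ y, 𝒳.h k y = z.2 → dist (g z) (f (z.1, y)) < ε) →
      ∀ᶠ z' in 𝓝 z, ∀ y, 𝒳.h k y = z'.2 → dist (g z') (f (z'.1, y)) < ε := by
    intro g z hz
    let B : Set (T × 𝒳.Y) := {b | ε ≤ dist (g (b.1, 𝒳.h k b.2)) (f b)}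
    have hB : IsClosed B := isClosed_le (by fun_prop) (by fun_prop)
    have hB' : IsClosed ((fun b : T × 𝒳.Y => (b.1, 𝒳.h k b.2)) '' B) :=
      (hB.isCompact.image (by fun_prop)).isClosed
    filter_upwards [hB'.isOpen_compl.mem_nhds (x := z) (by
      rintro ⟨b, hb, rfl⟩
      exact absurd (hz b.2 rfl) (not_lt.2 hb))] with z' hz' y hy
    by_contra hlt
    refine hz' ⟨(z'.1, y), ?_, Prod.ext rfl hy⟩
    change ε ≤ dist (g (z'.1, 𝒳.h k y)) (f (z'.1, y))
    rw [hy]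
    exact not_lt.1 hlt
  -- Both requirements are convex, so local solutions can be patched by a partition of unity. Over
  -- `S` use the Tietze extension `e`; away from `S` use one value of `f` on the fibre, which is
  -- within `ε` of the others by the choice of `k`, or `0` if the fibre is empty.
  obtain ⟨g, hg⟩ := exists_continuous_forall_mem_convex_of_local
    (t := fun z : T × 𝒳.X k => {c : V | (∀ hz : z.1 ∈ S, c = a (⟨z.1, hz⟩, 𝒳.p hik z.2)) ∧
      ∀ y, 𝒳.h k y = z.2 → dist c (f (z.1, y)) < ε})
    (fun z => by
      refine Convex.inter ?_ ?_
      · change Convex ℝ {c : V | ∀ hz : z.1 ∈ S, c = a (⟨z.1, hz⟩, 𝒳.p hik z.2)}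
        simp only [Set.ofPred_forall]
        exact convex_iInter fun hz => convex_singleton _
      · change Convex ℝ {c : V | ∀ y, 𝒳.h k y = z.2 → dist c (f (z.1, y)) < ε}
        simp only [Set.ofPred_forall]
        exact convex_iInter fun y => convex_iInter fun _ => convex_ball _ _)
    (fun z => by
      by_cases hz : z.1 ∈ S
      · refine ⟨_, near e z fun y hy => ?_, e, e.continuous.continuousOn, fun z' hz' =>
          ⟨fun hs => he' ⟨z'.1, hs⟩ z'.2, hz'⟩⟩
        have h1 := he' ⟨z.1, hz⟩ z.2
        have h2 := haf ⟨z.1, hz⟩ y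
        change e z = _ at h1
        change f (z.1, y) = _ at h2
        rw [h1, h2, ← hy, 𝒳.p_h, dist_self]
        exact hε
      · by_cases hy : ∃ y, 𝒳.h k y = z.2
        · obtain ⟨y₀, hy₀⟩ := hy
          refine ⟨_, Filter.inter_mem (hS'.isOpen_compl.mem_nhds hz)
            (near (ContinuousMap.const _ (f (z.1, y₀))) z fun y hy =>
              hk z.1 y₀ y (hy₀.trans hy.symm)), fun _ => f (z.1, y₀), continuousOn_const,
            fun z' hz' => ⟨fun hs => absurd hs hz'.1, hz'.2⟩⟩
        · refine ⟨_, Filter.inter_mem (hS'.isOpen_compl.mem_nhds hz)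
            (near (ContinuousMap.const _ 0) z fun y hy' => absurd ⟨y, hy'⟩ hy), fun _ => 0,
            continuousOn_const, fun z' hz' => ⟨fun hs => absurd hs hz'.1, hz'.2⟩⟩)
  exact ⟨k, hik, g, fun s x => (hg (s.1, x)).1 s.2, fun t y => (hg (t, 𝒳.h k y)).2 y rfl⟩

/-- Continuity of the space of maps into an open subset of a finite-dimensional space. -/
theorem isWeakColimit_maps_of_isOpen {V : Type v} [NormedAddCommGroup V] [NormedSpace ℝ V]
    [FiniteDimensional ℝ V] {O : Set V} (hO : IsOpen O) : (𝒳.maps O).IsWeakColimit := by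
  intro T _ _ _ S hS i (a : C(S, C(𝒳.X i, O))) (f : C(T, C(𝒳.Y, O))) haf
  let f' : C(T × 𝒳.Y, V) := ⟨fun z => (f.uncurry z).1, by fun_prop⟩
  obtain ⟨ε, hε, hεO⟩ := (isCompact_range f'.continuous).exists_thickening_subset_open hO (by
    rintro _ ⟨z, rfl⟩
    exact (f.uncurry z).2)
  have hball : ∀ z c, dist c (f' z) < ε → c ∈ O := fun z c hc =>
    hεO (Metric.mem_thickening_iff.2 ⟨f' z, ⟨z, rfl⟩, hc⟩)
  obtain ⟨k, hik, g, hgS, hg⟩ := 𝒳.exists_approx hS.1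
    ⟨fun z => (a.uncurry z).1, by fun_prop⟩ f' (fun s y =>
      congrArg (fun c : C(𝒳.Y, O) => (c y).1) (haf s)) hε
  -- The values of `g` lie in `O` over the image of the limit, but perhaps not on all of `X k`. A
  -- later stage maps entirely into the open set where they do.
  have hW : IsOpen {x : 𝒳.X k | ∀ t, g (t, x) ∈ O} := by
    have h1 := (ContinuousMap.isOpen_setOfPred_mapsTo (isCompact_univ (X := T)) hO).preimage
      (g.comp ⟨Prod.swap, continuous_swap⟩).curry.continuous
    refine (congrArg IsOpen (Set.ext fun x => ?_)).mp h1
    exact ⟨fun hx t => hx (Set.mem_univ t), fun hx t _ => hx t⟩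
  obtain ⟨l, hkl, hl⟩ := 𝒳.exists_range_subset hW fun y t => hball (t, y) _ (hg t y)
  let c : C(T × 𝒳.X l, O) := ⟨fun z => ⟨g (z.1, 𝒳.p hkl z.2), hl z.2 z.1⟩, by fun_prop⟩
  let G : C((T × I) × 𝒳.Y, V) :=
    ⟨fun z => AffineMap.lineMap (g (z.1.1, 𝒳.h k z.2)) (f' (z.1.1, z.2)) (z.1.2 : ℝ), by
      simp only [AffineMap.lineMap_apply_module]
      fun_prop⟩
  have hG : ∀ z, G z ∈ O := fun z => hball (z.1.1, z.2) _ (by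
    have h1 := hg z.1.1 z.2
    change dist (AffineMap.lineMap _ _ _) _ < ε
    rw [dist_lineMap_right]
    refine lt_of_le_of_lt (mul_le_of_le_one_left dist_nonneg ?_) h1
    rw [Real.norm_eq_abs, abs_le]
    constructor <;> linarith [z.1.2.2.1, z.1.2.2.2])
  refine ⟨l, hik.trans hkl, c.curry, fun s => ContinuousMap.ext fun x => Subtype.ext ?_,
    homotopicRel_iff.2 ⟨ContinuousMap.curry ⟨fun z => ⟨G z, hG z⟩, by fun_prop⟩, fun t => ?_,
      fun t => ?_, fun s hs r => ?_⟩⟩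
  · refine (hgS s _).trans ?_
    rw [𝒳.p_p]
    rfl
  · refine ContinuousMap.ext fun y => Subtype.ext ?_
    change AffineMap.lineMap (g (t, 𝒳.h k y)) _ ((0 : I) : ℝ) = g (t, 𝒳.p hkl (𝒳.h l y))
    rw [𝒳.p_h]
    simp
  · refine ContinuousMap.ext fun y => Subtype.ext ?_
    change AffineMap.lineMap _ (f' (t, y)) ((1 : I) : ℝ) = f' (t, y)
    simp
  · refine ContinuousMap.ext fun y => Subtype.ext ?_
    change AffineMap.lineMap (g (s, 𝒳.h k y)) (f' (s, y)) (r : ℝ) = g (s, 𝒳.p hkl (𝒳.h l y))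
    have h1 : f' (s, y) = g (s, 𝒳.h k y) := by
      refine Eq.trans ?_ (hgS ⟨s, hs⟩ _).symm
      rw [𝒳.p_h]
      exact congrArg (fun c : C(𝒳.Y, O) => (c y).1) (haf ⟨s, hs⟩)
    rw [𝒳.p_h, h1, AffineMap.lineMap_same_apply]

end CompactLimit

/-! ### Attaching cells -/

section Gluing

/-- A map from a compact space to a Hausdorff space is closed, hence a quotient map onto its image.
-/
theorem continuousOn_image_of_comp {Y W Z : Type*} [TopologicalSpace Y] [TopologicalSpace W]
    [TopologicalSpace Z] [CompactSpace Y] [T2Space W] {m : Y → W} (hm : Continuous m) {F : W → Z}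
    (hF : Continuous fun y => F (m y)) : ContinuousOn F (Set.range m) := by
  rw [continuousOn_iff_isClosed]
  intro t ht
  refine ⟨m '' ((fun y => F (m y)) ⁻¹' t), ((ht.preimage hF).isCompact.image hm).isClosed, ?_⟩
  ext w
  constructor
  · rintro ⟨hw, y, rfl⟩
    exact ⟨⟨y, hw, rfl⟩, y, rfl⟩
  · rintro ⟨⟨y, hy, rfl⟩, -⟩
    exact ⟨hy, y, rfl⟩

/-- Extending a continuous map over the image of a compact space. -/
theorem exists_extend_range {Q W Z : Type*} [TopologicalSpace Q] [TopologicalSpace W]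
    [TopologicalSpace Z] [CompactSpace Q] [T2Space W] {B : Set W} (hB : IsClosed B) {f : W → Z}
    (hf : ContinuousOn f B) {m : Q → W} (hm : Continuous m) {g : Q → Z} (hg : Continuous g)
    (hfg : ∀ q, m q ∈ B → f (m q) = g q) (hinj : ∀ q q', m q ∉ B → m q = m q' → q = q') :
    ∃ F : W → Z, ContinuousOn F (B ∪ Set.range m) ∧ (∀ w ∈ B, F w = f w) ∧
      ∀ q, F (m q) = g q := by
  classical
  let F : W → Z := fun w =>
    if w ∈ B then f w else if h : ∃ q, m q = w then g h.choose else f w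
  have hFB : ∀ w ∈ B, F w = f w := fun w hw => if_pos hw
  have hFm : ∀ q, F (m q) = g q := fun q => by
    by_cases hq : m q ∈ B
    · rw [hFB _ hq, hfg q hq]
    · have h : ∃ q', m q' = m q := ⟨q, rfl⟩
      simp only [F, if_neg hq, dif_pos h]
      exact congrArg g (hinj q h.choose hq h.choose_spec.symm).symm
  refine ⟨F, ContinuousOn.union_of_isClosed (hf.congr hFB)
    (continuousOn_image_of_comp hm ?_) hB (isCompact_range hm).isClosed, hFB, hFm⟩
  simpa only [hFm] using hg

end Gluing

section Cells

variable {K : Type u} [TopologicalSpace K]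

/-- `P` attaches an open cell to `L`. -/
structure IsAttaching (L : Set K) {n : ℕ} (P : C(Metric.closedBall (0 : Fin n → ℝ) 1, K)) :
    Prop where
  mem_iff : ∀ y, P y ∈ L ↔ ‖y.1‖ = 1
  inj : ∀ y y', P y ∉ L → P y = P y' → y = y'

/-- `L` is obtained from `A` by attaching finitely many cells. -/
inductive CellBuilt (A : Set K) : Set K → Prop
  | base : CellBuilt A A
  | attach {L : Set K} {n : ℕ} {P : C(Metric.closedBall (0 : Fin n → ℝ) 1, K)} :
    CellBuilt A L → IsAttaching L P → CellBuilt A (L ∪ Set.range P)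

theorem CellBuilt.subset {A L : Set K} (h : CellBuilt A L) : A ⊆ L := by
  induction h with
  | base => exact subset_rfl
  | attach _ _ ih => exact ih.trans Set.subset_union_left

theorem CellBuilt.isClosed [T2Space K] {A L : Set K} (h : CellBuilt A L) (hA : IsClosed A) :
    IsClosed L := by
  induction h with
  | base => exact hA
  | attach _ _ ih => exact ih.union (isCompact_range (ContinuousMap.continuous _)).isClosed

theorem CellBuilt.isCompact {A L : Set K} (h : CellBuilt A L) (hA : IsCompact A) :
    IsCompact L := by
  induction h with
  | base => exact hA
  | attach _ _ ih => exact ih.union (isCompact_range (ContinuousMap.continuous _))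

/-- Induction on the cells: over a new cell, first retract ball times interval onto its bottom and
side, then apply the retraction already built for `L`. -/
theorem CellBuilt.exists_retraction [T2Space K] {A L : Set K} (h : CellBuilt A L)
    (hA : IsClosed A) : ∃ r : K × I → K × I, ContinuousOn r {z | z.2 = 0 ∨ z.1 ∈ L} ∧
      (∀ z : K × I, z.2 = 0 ∨ z.1 ∈ L → (r z).2 = 0 ∨ (r z).1 ∈ A) ∧
      ∀ z : K × I, z.2 = 0 ∨ z.1 ∈ A → r z = z := by
  induction h with
  | base => exact ⟨id, continuousOn_id, fun _ h => h, fun _ _ => rfl⟩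
  | @attach L n P hL hP ih =>
    obtain ⟨r, hrc, hr, hrA⟩ := ih
    obtain ⟨-, ρ, hρ, hρ'⟩ := isCofib_sphere (Fin n → ℝ)
    let m : Metric.closedBall (0 : Fin n → ℝ) 1 × I → K × I := fun q => (P q.1, q.2)
    have hm : Continuous m := by fun_prop
    have hmB : ∀ q, m q ∈ {z : K × I | z.2 = 0 ∨ z.1 ∈ L} ↔ q.2 = 0 ∨ ‖q.1.1‖ = 1 := fun q =>
      or_congr Iff.rfl (hP.mem_iff q.1)
    obtain ⟨F, hFc, hFB, hFm⟩ := exists_extend_range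
      (isClosed_zero_or_mem (hL.isClosed hA)) hrc hm (g := fun q => r (m (ρ q)))
      (hrc.comp_continuous (hm.comp ρ.continuous) fun q => (hmB _).2 (hρ q))
      (fun q hq => by rw [hρ' q ((hmB q).1 hq)])
      (fun q q' hq hqq' => by
        have h1 : P q.1 ∉ L := fun h => hq (Or.inr h)
        exact Prod.ext (hP.inj _ _ h1 (congrArg Prod.fst hqq')) (congrArg (fun z => z.2) hqq'))
    have hcover : ∀ z : K × I, z.2 = 0 ∨ z.1 ∈ L ∪ Set.range P →
        z ∈ {z : K × I | z.2 = 0 ∨ z.1 ∈ L} ∪ Set.range m := by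
      rintro ⟨x, t⟩ (h | h | ⟨y, rfl⟩)
      exacts [Or.inl (Or.inl h), Or.inl (Or.inr h), Or.inr ⟨(y, t), rfl⟩]
    refine ⟨F, hFc.mono hcover, fun z hz => ?_, fun z hz => ?_⟩
    · rcases hcover z hz with h | ⟨q, rfl⟩
      · rw [hFB z h]
        exact hr z h
      · rw [hFm]
        exact hr _ ((hmB _).2 (hρ q))
    · rw [hFB z (hz.imp id fun h => hL.subset h)]
      exact hrA z hz

theorem CellBuilt.isCofib [T2Space K] {A : Set K} (h : CellBuilt A Set.univ) (hA : IsClosed A) :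
    IsCofib A := by
  obtain ⟨r, hrc, hr, hrA⟩ := h.exists_retraction hA
  exact ⟨hA, ⟨r, continuousOn_univ.1 (hrc.mono fun z _ => Or.inr trivial)⟩,
    fun z => hr z (Or.inr trivial), hrA⟩

end Cells

/-! ### Cell structures of CW complexes -/

section CW

open Topology RelCWComplex

variable {K : Type u} [TopologicalSpace K] [CWComplex (Set.univ : Set K)]

/-- Attach the cells of `F` in order of dimension, so that the frontier of each is present when it
is attached. Cells already in `A` change nothing. -/
theorem cellBuilt_union_openCell [T2Space K] (A : Subcomplex (Set.univ : Set K))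
    (F : Finset (Σ n, cell (Set.univ : Set K) n))
    (hF : ∀ e ∈ F, cellFrontier e.1 e.2 ⊆
      A ∪ ⋃ e' ∈ {e' ∈ F | e'.1 < e.1}, openCell e'.1 e'.2) :
    CellBuilt (A : Set K) (A ∪ ⋃ e ∈ F, openCell e.1 e.2) := by
  classical
  revert hF
  refine Finset.induction_on_max_value (fun e : Σ n, cell (Set.univ : Set K) n => e.1) F
    (fun _ => by simpa using CellBuilt.base) ?_
  · intro e F he hmax ih hF
    have hlow : ∀ e₁ ∈ insert e F, ∀ e' ∈ {e' ∈ insert e F | e'.1 < e₁.1}, e' ∈ F := by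
      intro e₁ he₁ e' he'
      rw [Finset.mem_filter, Finset.mem_insert] at he'
      rcases he'.1 with rfl | h
      · rcases Finset.mem_insert.1 he₁ with rfl | h1
        · exact absurd he'.2 (lt_irrefl _)
        · exact absurd he'.2 (not_lt.2 (hmax _ h1))
      · exact h
    have ih' := ih fun e₁ he₁ => (hF e₁ (Finset.mem_insert_of_mem he₁)).trans
      (Set.union_subset_union_right _ (Set.iUnion₂_subset fun e' he' =>
        Set.subset_iUnion₂_of_subset e' (Finset.mem_filter.2
          ⟨hlow e₁ (Finset.mem_insert_of_mem he₁) e' he', (Finset.mem_filter.1 he').2⟩) subset_rfl))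
    rw [Finset.set_biUnion_insert]
    by_cases heA : e.2 ∈ A.I e.1
    · have h1 : openCell e.1 e.2 ⊆ (A : Set K) := A.openCell_subset_of_mem heA
      rwa [← Set.union_assoc, Set.union_eq_self_of_subset_right h1]
    · set L : Set K := A ∪ ⋃ e ∈ F, openCell e.1 e.2
      have hdisj : Disjoint (openCell e.1 e.2) L := by
        refine Set.disjoint_union_right.2
          ⟨A.disjoint_openCell_subcomplex_of_not_mem heA, ?_⟩
        simp only [Set.disjoint_iUnion_right]
        intro e' he'
        refine disjoint_openCell_of_ne fun h => he ?_
        have : e = e' := h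
        exact this ▸ he'
      have hfr : cellFrontier e.1 e.2 ⊆ L := (hF e (Finset.mem_insert_self e F)).trans
        (Set.union_subset_union_right _ (Set.iUnion₂_subset fun e' he' =>
          Set.subset_iUnion₂_of_subset e' (hlow e (Finset.mem_insert_self e F) e' he') subset_rfl))
      let P : C(Metric.closedBall (0 : Fin e.1 → ℝ) 1, K) :=
        ⟨fun y => map e.1 e.2 y.1, (continuousOn e.1 e.2).comp_continuous
          continuous_subtype_val fun y => y.2⟩
      have hball : ∀ y : Metric.closedBall (0 : Fin e.1 → ℝ) 1, ‖y.1‖ ≠ 1 →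
          y.1 ∈ Metric.ball (0 : Fin e.1 → ℝ) 1 := fun y hy =>
        mem_ball_zero_iff.2 (lt_of_le_of_ne (mem_closedBall_zero_iff.1 y.2) hy)
      have hout : ∀ y : Metric.closedBall (0 : Fin e.1 → ℝ) 1, ‖y.1‖ ≠ 1 → P y ∉ L :=
        fun y hy => Set.disjoint_left.1 hdisj ⟨y.1, hball y hy, rfl⟩
      have hin : ∀ y : Metric.closedBall (0 : Fin e.1 → ℝ) 1, ‖y.1‖ = 1 → P y ∈ L :=
        fun y hy => hfr ⟨y.1, mem_sphere_zero_iff_norm.2 hy, rfl⟩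
      have hP : IsAttaching L P := by
        refine ⟨fun y => ⟨fun h => by_contra fun hy => hout y hy h, hin y⟩,
          fun y y' hy hyy' => Subtype.ext ?_⟩
        have h1 : ‖y.1‖ ≠ 1 := fun h => hy (hin y h)
        have h2 : ‖y'.1‖ ≠ 1 := fun h => hy (hyy' ▸ hin y' h)
        refine (map e.1 e.2).injOn ?_ ?_ hyy'
        · rw [source_eq]
          exact hball y h1
        · rw [source_eq]
          exact hball y' h2
      have hunion : L ∪ Set.range P = (A : Set K) ∪ (openCell e.1 e.2 ∪ ⋃ e ∈ F, openCell e.1 e.2) := by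
        have h1 : Set.range P = closedCell e.1 e.2 := by
          ext x
          constructor
          · rintro ⟨y, rfl⟩
            exact ⟨y.1, y.2, rfl⟩
          · rintro ⟨y, hy, rfl⟩
            exact ⟨⟨y, hy⟩, rfl⟩
        rw [h1, ← cellFrontier_union_openCell_eq_closedCell, ← Set.union_assoc,
          Set.union_eq_self_of_subset_right hfr, Set.union_assoc, Set.union_comm (openCell _ _)]
      rw [← hunion]
      exact ih'.attach hP

/-- A finite CW complex is obtained from a subcomplex by attaching finitely many cells. -/
theorem cellBuilt_univ [T2Space K] [RelCWComplex.Finite (Set.univ : Set K)]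
    (A : Subcomplex (Set.univ : Set K)) : CellBuilt (A : Set K) Set.univ := by
  classical
  have := finite_cells_of_finite (C := (Set.univ : Set K))
  have := Fintype.ofFinite (Σ n, cell (Set.univ : Set K) n)
  have h := cellBuilt_union_openCell A Finset.univ fun e _ x hx => by
    obtain ⟨J, hJ⟩ := CWComplex.cellFrontier_subset_finite_openCell e.1 e.2
    have := hJ hx
    simp only [Set.mem_iUnion] at this
    obtain ⟨k, hk, j, -, hj⟩ := this
    refine Or.inr (Set.mem_iUnion₂.2 ⟨⟨k, j⟩, ?_, hj⟩)
    simpa using hk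
  have hu : (A : Set K) ∪ ⋃ e ∈ (Finset.univ : Finset (Σ n, cell (Set.univ : Set K) n)),
      openCell e.1 e.2 = Set.univ := by
    refine Set.eq_univ_of_forall fun x => Or.inr ?_
    have hx : x ∈ (⋃ (n : ℕ) (j : cell (Set.univ : Set K) n), openCell n j) := by
      rw [CWComplex.iUnion_openCell_eq_complex]
      trivial
    simp only [Set.mem_iUnion] at hx ⊢
    obtain ⟨n, j, hj⟩ := hx
    exact ⟨⟨n, j⟩, Finset.mem_univ _, hj⟩
  rwa [hu] at h

/-- Closure finiteness and strong induction on dimension: adjoin the families of the finitely many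
cells that meet the frontier. -/
theorem exists_finset_cells_of_cell (e : Σ n, cell (Set.univ : Set K) n) :
    ∃ F : Finset (Σ n, cell (Set.univ : Set K) n), e ∈ F ∧ ∀ e₁ ∈ F,
      cellFrontier e₁.1 e₁.2 ⊆ ⋃ e' ∈ {e' ∈ F | e'.1 < e₁.1}, openCell e'.1 e'.2 := by
  classical
  obtain ⟨n, i⟩ := e
  induction n using Nat.strong_induction_on with
  | _ n ih =>
    obtain ⟨J, hJ⟩ := CWComplex.cellFrontier_subset_finite_openCell n i
    choose! G hG hG' using ih
    let F₀ : Finset (Σ n, cell (Set.univ : Set K) n) :=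
      (Finset.range n).biUnion fun m => (J m).biUnion fun j => G m j
    have hF₀ : ∀ m < n, ∀ j ∈ J m, ∀ e' ∈ G m j, e' ∈ F₀ := fun m hm j hj e' he' =>
      Finset.mem_biUnion.2 ⟨m, Finset.mem_range.2 hm, Finset.mem_biUnion.2 ⟨j, hj, he'⟩⟩
    refine ⟨insert ⟨n, i⟩ F₀, Finset.mem_insert_self _ _, fun e₁ he₁ x hx => ?_⟩
    rcases Finset.mem_insert.1 he₁ with rfl | h
    · have := hJ hx
      simp only [Set.mem_iUnion] at this
      obtain ⟨m, hm, j, hj, hxj⟩ := this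
      exact Set.mem_iUnion₂.2 ⟨⟨m, j⟩, Finset.mem_filter.2
        ⟨Finset.mem_insert_of_mem (hF₀ m hm j hj _ (hG m hm j)), hm⟩, hxj⟩
    · obtain ⟨m, hm, h⟩ := Finset.mem_biUnion.1 h
      obtain ⟨j, hj, h⟩ := Finset.mem_biUnion.1 h
      rw [Finset.mem_range] at hm
      obtain ⟨e', he', hx'⟩ := Set.mem_iUnion₂.1 (hG' m hm j e₁ h hx)
      rw [Finset.mem_filter] at he'
      exact Set.mem_iUnion₂.2 ⟨e', Finset.mem_filter.2
        ⟨Finset.mem_insert_of_mem (hF₀ m hm j hj _ he'.1), he'.2⟩, hx'⟩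

theorem exists_finset_cells (F₀ : Finset (Σ n, cell (Set.univ : Set K) n)) :
    ∃ F : Finset (Σ n, cell (Set.univ : Set K) n), F₀ ⊆ F ∧ ∀ e₁ ∈ F,
      cellFrontier e₁.1 e₁.2 ⊆ ⋃ e' ∈ {e' ∈ F | e'.1 < e₁.1}, openCell e'.1 e'.2 := by
  classical
  choose G hG hG' using exists_finset_cells_of_cell (K := K)
  refine ⟨F₀.biUnion G, fun e he => Finset.mem_biUnion.2 ⟨e, he, hG e⟩, fun e₁ he₁ x hx => ?_⟩
  obtain ⟨e, he, h⟩ := Finset.mem_biUnion.1 he₁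
  obtain ⟨e', he', hx'⟩ := Set.mem_iUnion₂.1 (hG' e e₁ h hx)
  rw [Finset.mem_filter] at he'
  exact Set.mem_iUnion₂.2 ⟨e', Finset.mem_filter.2
    ⟨Finset.mem_biUnion.2 ⟨e, he, he'.1⟩, he'.2⟩, hx'⟩

/-- A closed cell meets only finitely many open cells. -/
theorem finite_openCell_inter_closedCell (n : ℕ) (i : cell (Set.univ : Set K) n) :
    {e : Σ n, cell (Set.univ : Set K) n |
      (openCell e.1 e.2 ∩ closedCell n i).Nonempty}.Finite := by
  classical
  obtain ⟨J, hJ⟩ := CWComplex.cellFrontier_subset_finite_openCell n i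
  refine (((Finset.range n).sigma J).finite_toSet.insert ⟨n, i⟩).subset ?_
  rintro e ⟨x, hxe, hx⟩
  rw [← cellFrontier_union_openCell_eq_closedCell] at hx
  rcases hx with hx | hx
  · have := hJ hx
    simp only [Set.mem_iUnion] at this
    obtain ⟨m, hm, j, hj, hxj⟩ := this
    have : e = ⟨m, j⟩ := eq_of_not_disjoint_openCell (Set.not_disjoint_iff.2 ⟨x, hxe, hxj⟩)
    subst this
    right
    simpa using ⟨hm, hj⟩
  · left
    exact eq_of_not_disjoint_openCell (Set.not_disjoint_iff.2 ⟨x, hxe, hx⟩)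

/-- A compact subset of a CW complex meets only finitely many open cells. -/
theorem finite_openCell_inter_of_isCompact [T2Space K] {C : Set K} (hC : IsCompact C) :
    {e : Σ n, cell (Set.univ : Set K) n | (openCell e.1 e.2 ∩ C).Nonempty}.Finite := by
  classical
  set M := {e : Σ n, cell (Set.univ : Set K) n | (openCell e.1 e.2 ∩ C).Nonempty}
  obtain hK | hK := isEmpty_or_nonempty K
  · exact Set.finite_empty.subset fun e he => (hK.false he.some).elim
  choose! x hx using fun e (he : e ∈ M) => he
  have hinj : Set.InjOn x M := fun e he e' he' h => eq_of_not_disjoint_openCell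
    (Set.not_disjoint_iff.2 ⟨x e, (hx e he).1, h ▸ (hx e' he').1⟩)
  -- With one point of `C` chosen in each open cell, every set of chosen points meets each closed
  -- cell in a finite set, so it is closed. The chosen points thus form a compact discrete set.
  have hcl : ∀ N ⊆ M, IsClosed (x '' N) := fun N hN => by
    rw [CWComplex.closed Set.univ _ (Set.subset_univ _)]
    intro n j
    refine Set.Finite.isClosed (((finite_openCell_inter_closedCell n j).image x).subset ?_)
    rintro _ ⟨⟨e, he, rfl⟩, h⟩
    exact ⟨e, ⟨x e, (hx e (hN he)).1, h⟩, rfl⟩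
  have hdisc : IsDiscrete (x '' M) := by
    rw [isDiscrete_iff_forall_mem_exists_isOpen]
    rintro _ ⟨e, he, rfl⟩
    refine ⟨(x '' (M \ {e}))ᶜ, (hcl _ Set.sdiff_subset).isOpen_compl, ?_⟩
    ext y
    constructor
    · rintro ⟨h1, e', he', rfl⟩
      by_contra hne
      exact h1 ⟨e', ⟨he', fun h => hne (congrArg x h)⟩, rfl⟩
    · rintro rfl
      refine ⟨?_, e, he, rfl⟩
      rintro ⟨e', ⟨he', hne⟩, h⟩
      exact hne (hinj he' he h)
  have hcomp : IsCompact (x '' M) := hC.of_isClosed_subset (hcl M subset_rfl) (by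
    rintro _ ⟨e, he, rfl⟩
    exact (hx e he).2)
  exact Set.Finite.of_finite_image (hcomp.finite hdisc) hinj

/-- A compact subset of a CW complex is contained in a finite subcomplex. -/
theorem exists_cellBuilt_of_isCompact [T2Space K] {C : Set K} (hC : IsCompact C) :
    ∃ L, CellBuilt (∅ : Set K) L ∧ C ⊆ L := by
  classical
  have hfin := finite_openCell_inter_of_isCompact hC
  obtain ⟨F, hF₀, hF⟩ := exists_finset_cells hfin.toFinset
  have hbot : ((skeletonLT (Set.univ : Set K) 0 : Subcomplex (Set.univ : Set K)) : Set K) = ∅ :=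
    CWComplex.skeletonLT_zero_eq_empty
  have h := cellBuilt_union_openCell (skeletonLT (Set.univ : Set K) 0) F fun e he =>
    (hF e he).trans Set.subset_union_right
  rw [hbot, Set.empty_union] at h
  refine ⟨_, h, fun x hxC => ?_⟩
  have hx : x ∈ (⋃ (n : ℕ) (j : cell (Set.univ : Set K) n), openCell n j) := by
    rw [CWComplex.iUnion_openCell_eq_complex]
    trivial
  simp only [Set.mem_iUnion] at hx
  obtain ⟨n, j, hj⟩ := hx
  exact Set.mem_iUnion₂.2 ⟨⟨n, j⟩, hF₀ (hfin.mem_toFinset.2 ⟨x, hj, hxC⟩), hj⟩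

end CW

/-! ### Finite cell complexes are dominated by open subsets of finite-dimensional spaces -/

section Domination

variable {K : Type u} [TopologicalSpace K]

/-- `L` is homotopy dominated by an open subset of a finite-dimensional vector space. -/
def IsOpenDominated (L : Set K) : Prop :=
  ∃ (V : Type) (_ : NormedAddCommGroup V) (_ : NormedSpace ℝ V) (_ : FiniteDimensional ℝ V)
    (O : Set V) (i : K → V) (r : V → K) (h : K × I → K), IsOpen O ∧
    ContinuousOn i L ∧ Set.MapsTo i L O ∧ ContinuousOn r O ∧ Set.MapsTo r O L ∧
    ContinuousOn h {z | z.1 ∈ L} ∧ (∀ z : K × I, z.1 ∈ L → h z ∈ L) ∧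
    ∀ x ∈ L, h (x, 0) = r (i x) ∧ h (x, 1) = x

theorem isOpenDominated_empty [Nonempty K] : IsOpenDominated (∅ : Set K) :=
  ⟨ℝ, inferInstance, inferInstance, inferInstance, ∅, fun _ => 0,
    fun _ => Classical.arbitrary K, fun z => z.1, isOpen_empty, continuousOn_empty _,
    Set.mapsTo_empty _ _, continuousOn_empty _, Set.mapsTo_empty _ _,
    continuous_fst.continuousOn, fun _ h => h, fun _ h => h.elim⟩

/-- The direction of a vector, as an element of the closed unit ball. -/
noncomputable def ballDir {W : Type*} [NormedAddCommGroup W] [NormedSpace ℝ W] (y : W) :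
    Metric.closedBall (0 : W) 1 :=
  ⟨‖y‖⁻¹ • y, by
    rw [mem_closedBall_zero_iff, norm_smul, norm_inv, norm_norm]
    exact inv_mul_le_one⟩

/-- Scaling in the closed unit ball. -/
def ballScale {W : Type*} [NormedAddCommGroup W] [NormedSpace ℝ W] :
    C(I × Metric.closedBall (0 : W) 1, Metric.closedBall (0 : W) 1) :=
  ⟨fun z => ⟨(z.1 : ℝ) • z.2.1, by
    rw [mem_closedBall_zero_iff, norm_smul, Real.norm_of_nonneg z.1.2.1]
    exact mul_le_one₀ z.1.2.2 (norm_nonneg _) (mem_closedBall_zero_iff.1 z.2.2)⟩, by fun_prop⟩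

/-! ### Polar coordinates in the unit ball -/

section Ball

variable {W : Type*} [NormedAddCommGroup W] [NormedSpace ℝ W]

theorem norm_ballDir {y : W} (hy : y ≠ 0) : ‖(ballDir y).1‖ = 1 := by
  change ‖‖y‖⁻¹ • y‖ = 1
  rw [norm_smul, norm_inv, norm_norm, inv_mul_cancel₀ (norm_ne_zero_iff.2 hy)]

theorem ballDir_smul {y : W} {c : ℝ} (hc : 0 < c) : ballDir (c • y) = ballDir y := by
  refine Subtype.ext ?_
  change ‖c • y‖⁻¹ • c • y = ‖y‖⁻¹ • y
  rw [norm_smul, Real.norm_of_nonneg hc.le, smul_smul, mul_inv, mul_right_comm,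
    inv_mul_cancel₀ hc.ne', one_mul]

theorem ballDir_of_norm_eq_one {y : Metric.closedBall (0 : W) 1} (hy : ‖y.1‖ = 1) :
    ballDir y.1 = y :=
  Subtype.ext (by
    change ‖y.1‖⁻¹ • y.1 = y.1
    rw [hy, inv_one, one_smul])

theorem continuousAt_ballDir {y : W} (hy : y ≠ 0) : ContinuousAt ballDir y := by
  refine Topology.IsInducing.subtypeVal.continuousAt_iff.2
    (ContinuousAt.smul (ContinuousAt.inv₀ ?_ ?_) continuousAt_id)
  · exact continuous_norm.continuousAt
  · exact norm_ne_zero_iff.2 hy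

theorem norm_smul_ballDir (y : W) : ‖y‖ • (ballDir y).1 = y := by
  change ‖y‖ • ‖y‖⁻¹ • y = y
  by_cases hy : y = 0
  · simp [hy]
  · rw [smul_smul, mul_inv_cancel₀ (norm_ne_zero_iff.2 hy), one_smul]

end Ball

theorem continuousOn_ite_le {Y Z : Type*} [TopologicalSpace Y] [TopologicalSpace Z] {s : Set Y}
    {τ : Y → ℝ} (hτ : Continuous τ) (a : ℝ) {f g : Y → Z}
    (hf : ContinuousOn f (s ∩ {y | τ y ≤ a})) (hg : ContinuousOn g (s ∩ {y | a ≤ τ y}))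
    (hfg : ∀ y ∈ s, τ y = a → f y = g y) :
    ContinuousOn (fun y => if τ y ≤ a then f y else g y) s := by
  refine ContinuousOn.if ?_ ?_ ?_
  · rintro y ⟨hy, hya⟩
    exact hfg y hy (frontier_le_subset_eq hτ continuous_const hya)
  · refine hf.mono (Set.inter_subset_inter_right _ ?_)
    exact (isClosed_le hτ continuous_const).closure_subset_iff.2 subset_rfl
  · refine hg.mono (Set.inter_subset_inter_right _ ?_)
    exact (isClosed_le continuous_const hτ).closure_subset_iff.2 fun y hy => (not_le.1 hy).le

/-! ### Open domination survives attaching a cell -/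

section Attach

variable {n : ℕ} (P : C(Metric.closedBall (0 : Fin n → ℝ) 1, K)) (h : K × I → K)

/-- The path from the center of a cell through the boundary point `P u` and then backwards along
the homotopy `h`. -/
noncomputable def cellPath (z : Metric.closedBall (0 : Fin n → ℝ) 1 × ℝ) : K :=
  if z.2 ≤ 1 then P (ballScale (Set.projIcc 0 1 zero_le_one z.2, z.1))
  else h (P z.1, Set.projIcc 0 1 zero_le_one (2 - z.2))

variable {P h} {L : Set K}

theorem cellPath_of_le_zero (u : Metric.closedBall (0 : Fin n → ℝ) 1) {g : ℝ} (hg : g ≤ 0) :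
    cellPath P h (u, g) = P 0 := by
  have : cellPath P h (u, g) = P (ballScale (Set.projIcc 0 1 zero_le_one g, u)) :=
    if_pos (hg.trans zero_le_one)
  rw [this, Set.projIcc_of_le_left _ hg]
  exact congrArg P (Subtype.ext (zero_smul ℝ u.1))

/-- The branches agree at parameter `1`, where both give `P u`. Only unit `u` are allowed, since `h`
is controlled only on `L`. -/
theorem continuousOn_cellPath (hP : IsAttaching L P) (hc : ContinuousOn h {z | z.1 ∈ L})
    (h1 : ∀ x ∈ L, h (x, 1) = x) :
    ContinuousOn (cellPath P h) {z | ‖z.1.1‖ = 1} := by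
  refine continuousOn_ite_le continuous_snd 1 (Continuous.continuousOn ?_) ?_ ?_
  · have : Continuous fun z : Metric.closedBall (0 : Fin n → ℝ) 1 × ℝ =>
        Set.projIcc (0 : ℝ) 1 zero_le_one z.2 := continuous_projIcc.comp continuous_snd
    fun_prop
  · have : Continuous fun z : Metric.closedBall (0 : Fin n → ℝ) 1 × ℝ =>
        Set.projIcc (0 : ℝ) 1 zero_le_one (2 - z.2) := continuous_projIcc.comp (by fun_prop)
    refine hc.comp (Continuous.continuousOn (by fun_prop)) fun z hz => ?_
    exact (hP.mem_iff z.1).2 hz.1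
  · rintro ⟨u, g⟩ hu (rfl : g = 1)
    have h2 : (2 - 1 : ℝ) = 1 := by norm_num
    simp only [h2, Set.projIcc_right]
    rw [show (⟨1, _⟩ : I) = 1 from rfl, h1 _ ((hP.mem_iff u).2 hu)]
    exact congrArg P (Subtype.ext (one_smul ℝ u.1))

theorem cellPath_mem (hP : IsAttaching L P) (hL : ∀ z : K × I, z.1 ∈ L → h z ∈ L)
    {u : Metric.closedBall (0 : Fin n → ℝ) 1} {g : ℝ} (hu : ‖u.1‖ = 1 ∨ g ≤ 1) :
    cellPath P h (u, g) ∈ L ∪ Set.range P := by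
  by_cases hg : g ≤ 1
  · have : cellPath P h (u, g) = _ := if_pos hg
    rw [this]
    exact Or.inr ⟨_, rfl⟩
  · have : cellPath P h (u, g) = _ := if_neg hg
    rw [this]
    exact Or.inl (hL _ ((hP.mem_iff u).2 (hu.resolve_right hg)))

theorem cellPath_two_sub (hP : IsAttaching L P) (h1 : ∀ x ∈ L, h (x, 1) = x)
    {u : Metric.closedBall (0 : Fin n → ℝ) 1} (hu : ‖u.1‖ = 1) (s : I) :
    cellPath P h (u, 2 - s) = h (P u, s) := by
  by_cases hs : s = 1
  · subst hs
    have h2 : (2 - ((1 : I) : ℝ)) = 1 := by norm_num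
    rw [h1 _ ((hP.mem_iff u).2 hu), h2]
    have : cellPath P h (u, 1) = P (ballScale (Set.projIcc 0 1 zero_le_one 1, u)) :=
      if_pos (le_refl (1 : ℝ))
    rw [this, Set.projIcc_right]
    exact congrArg P (Subtype.ext (one_smul ℝ u.1))
  · have h2 : ¬ (2 - (s : ℝ) ≤ 1) := fun h3 => hs (le_antisymm s.2.2 (by
      change (1 : ℝ) ≤ s
      linarith))
    have : cellPath P h (u, 2 - s) = h (P u, Set.projIcc 0 1 zero_le_one (2 - (2 - (s : ℝ)))) :=
      if_neg h2
    rw [this, sub_sub_cancel, Set.projIcc_val]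

theorem cellPath_norm (y : Metric.closedBall (0 : Fin n → ℝ) 1) :
    cellPath P h (ballDir y.1, ‖y.1‖) = P y := by
  have hy := mem_closedBall_zero_iff.1 y.2
  have : cellPath P h (ballDir y.1, ‖y.1‖) =
      P (ballScale (Set.projIcc 0 1 zero_le_one ‖y.1‖, ballDir y.1)) := if_pos hy
  rw [this, Set.projIcc_of_mem _ ⟨norm_nonneg _, hy⟩]
  exact congrArg P (Subtype.ext (norm_smul_ballDir y.1))

/-- The new open set is a thickened mapping cylinder in `V × W × ℝ`. The last coordinate `t` is `0`
on `L` and `1 - ‖y‖` on the cell, and `W` records the direction in the cell. For `t < 1/3` the set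
is `O`, for `t > 2/3` it is everything, and the part `M` links them. The map `r'` applies `r` for `t
≤ 1/3`, then `r` along the segment from `v` to `φ w` up to `t = 4/9`, and then follows `cellPath`
from parameter `2` to parameter `0`, the centre of the cell, at `t = 2/3`. Thus `r' ∘ i'` moves
points only along the paths `cellPath`, and sliding the parameter back to `‖y‖` is the homotopy to
the identity. -/
theorem IsOpenDominated.attach [T2Space K] (hLcl : IsClosed L) (hP : IsAttaching L P)
    (hdom : IsOpenDominated L) : IsOpenDominated (L ∪ Set.range P) := by
  obtain ⟨V, _, _, _, O, i, r, h, hO, hi, hiO, hr, hrL, hh, hhL, hends⟩ := hdom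
  have hh1 : ∀ x ∈ L, h (x, 1) = x := fun x hx => (hends x hx).2
  let W := Fin n → ℝ
  have hPd : ∀ {y : W}, y ≠ 0 → P (ballDir y) ∈ L := fun hy => (hP.mem_iff _).2 (norm_ballDir hy)
  let φ : W → V := fun y => i (P (ballDir y))
  have hφ : ∀ y : W, y ≠ 0 → ContinuousAt φ y := fun y hy => by
    have h1 : ContinuousOn φ {y | y ≠ 0} := hi.comp
      (fun y hy => (P.continuous.continuousAt.comp (continuousAt_ballDir hy)).continuousWithinAt)
      fun y hy => hPd hy
    exact h1.continuousAt (isOpen_ne.mem_nhds hy)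
  have hφO : ∀ {y : W}, y ≠ 0 → φ y ∈ O := fun hy => hiO (hPd hy)
  let ℓ : V × W × ℝ → ℝ → V := fun z s => AffineMap.lineMap z.1 (φ z.2.1) s
  have hℓ : ∀ (z : V × W × ℝ) (s : ℝ), z.2.1 ≠ 0 →
      ContinuousAt (fun y : (V × W × ℝ) × ℝ => ℓ y.1 y.2) (z, s) := fun z s hz => by
    have h1 : ContinuousAt (fun y : (V × W × ℝ) × ℝ => φ y.1.2.1) (z, s) :=
      ContinuousAt.comp (g := φ) (f := fun y : (V × W × ℝ) × ℝ => y.1.2.1) (x := (z, s))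
        (hφ z.2.1 hz) (by fun_prop)
    simp only [ℓ, AffineMap.lineMap_apply_module]
    fun_prop
  let M : Set (V × W × ℝ) := {z | z.2.1 ≠ 0 ∧ ∀ s : I, ℓ z s ∈ O}
  have hM : IsOpen M := by
    refine isOpen_iff_mem_nhds.2 fun z hz => ?_
    have h1 : ∀ᶠ z' in 𝓝 z, ∀ s ∈ (Set.univ : Set I), ℓ z' s ∈ O :=
      isCompact_univ.eventually_forall_of_forall_eventually fun s _ => by
        have h2 : ContinuousAt (fun y : (V × W × ℝ) × I => ℓ y.1 y.2) (z, s) :=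
          ContinuousAt.comp (g := fun y : (V × W × ℝ) × ℝ => ℓ y.1 y.2)
            (f := fun y : (V × W × ℝ) × I => (y.1, (y.2 : ℝ))) (x := (z, s)) (hℓ z s hz.1)
            (by fun_prop)
        exact h2 (hO.mem_nhds (hz.2 s))
    have h2 : ∀ᶠ z' : V × W × ℝ in 𝓝 z, z'.2.1 ≠ 0 :=
      (isOpen_ne.preimage (continuous_fst.comp continuous_snd)).mem_nhds hz.1
    filter_upwards [h1, h2] with z' h1 h2 using ⟨h2, fun s => h1 s trivial⟩
  let O' : Set (V × W × ℝ) := {z | z.2.2 < 1 / 3 ∧ z.1 ∈ O} ∪ (M ∪ {z | 2 / 3 < z.2.2})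
  have hO' : IsOpen O' := by
    have ht : Continuous fun z : V × W × ℝ => z.2.2 := by fun_prop
    exact ((isOpen_lt ht continuous_const).inter (hO.preimage continuous_fst)).union
      (hM.union (isOpen_lt continuous_const ht))
  -- The map back to the cell complex.
  let r' : V × W × ℝ → K := fun z => if z.2.2 ≤ 4 / 9 then r (ℓ z (max 0 (9 * z.2.2 - 3)))
    else cellPath P h (ballDir z.2.1, max 0 (6 - 9 * z.2.2))
  have hℓ0 : ∀ z, ℓ z 0 = z.1 := fun z => AffineMap.lineMap_apply_zero _ _
  have hℓ1 : ∀ z, ℓ z 1 = φ z.2.1 := fun z => AffineMap.lineMap_apply_one _ _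
  have hcoef : ∀ t : ℝ, t ≤ 4 / 9 → max 0 (9 * t - 3) ∈ Set.Icc (0 : ℝ) 1 := fun t ht =>
    ⟨le_max_left _ _, max_le zero_le_one (by linarith)⟩
  have hr'1 : ∀ z, z.2.2 < 1 / 3 → r' z = r z.1 := fun z hz => by
    have h1 : max 0 (9 * z.2.2 - 3) = 0 := max_eq_left (by linarith)
    simp only [r']
    rw [if_pos (by linarith), h1, hℓ0]
  have hr'3 : ∀ z, 2 / 3 < z.2.2 → r' z = P 0 := fun z hz => by
    have h1 : max 0 (6 - 9 * z.2.2) = 0 := max_eq_left (by linarith)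
    simp only [r']
    rw [if_neg (by linarith), h1, cellPath_of_le_zero _ le_rfl]
  have hcell2 : ∀ y : W, y ≠ 0 → cellPath P h (ballDir y, 2) = r (φ y) := fun y hy => by
    have h1 := cellPath_two_sub hP hh1 (norm_ballDir hy) 0
    rw [(hends _ (hPd hy)).1] at h1
    simpa using h1
  have hr'M : ContinuousOn r' M := by
    refine continuousOn_ite_le (by fun_prop) (4 / 9) ?_ ?_ ?_
    · refine hr.comp (fun z hz => ContinuousAt.continuousWithinAt ?_) fun z hz => ?_
      · exact ContinuousAt.comp (g := fun y : (V × W × ℝ) × ℝ => ℓ y.1 y.2)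
          (f := fun z : V × W × ℝ => (z, max 0 (9 * z.2.2 - 3))) (x := z) (hℓ z _ hz.1.1) (by fun_prop)
      · exact hz.1.2 ⟨_, hcoef _ hz.2⟩
    · refine (continuousOn_cellPath hP hh hh1).comp
        (fun z hz => ContinuousAt.continuousWithinAt ?_) fun z hz => norm_ballDir hz.1.1
      refine ContinuousAt.prodMk ?_ (by fun_prop)
      exact ContinuousAt.comp (f := fun z : V × W × ℝ => z.2.1) (x := z) (continuousAt_ballDir hz.1.1)
        (by fun_prop)
    · intro z hz ht
      have h1 : max 0 (9 * z.2.2 - 3) = 1 := by rw [ht]; norm_num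
      have h2 : max 0 (6 - 9 * z.2.2) = 2 := by rw [ht]; norm_num
      rw [h1, h2, hℓ1, hcell2 _ hz.1]
  have hr'c : ContinuousOn r' O' := by
    rintro z (hz | hz | hz)
    · have h1 : ContinuousAt (fun z : V × W × ℝ => r z.1) z :=
        ContinuousAt.comp (f := fun z : V × W × ℝ => z.1) (x := z)
          (hr.continuousAt (hO.mem_nhds hz.2)) continuousAt_fst
      refine (h1.congr ?_).continuousWithinAt
      filter_upwards [(isOpen_lt (f := fun z : V × W × ℝ => z.2.2) (by fun_prop)
        continuous_const).mem_nhds hz.1] with z' hz' using (hr'1 z' hz').symm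
    · exact (hr'M.continuousAt (hM.mem_nhds hz)).continuousWithinAt
    · refine (continuousAt_const.congr (f := fun _ => P 0) ?_).continuousWithinAt
      filter_upwards [(isOpen_lt (g := fun z : V × W × ℝ => z.2.2) continuous_const
        (by fun_prop)).mem_nhds hz] with z' hz' using (hr'3 z' hz').symm
  have hr'L : Set.MapsTo r' O' (L ∪ Set.range P) := by
    rintro z (hz | hz | hz)
    · rw [hr'1 z hz.1]
      exact Or.inl (hrL hz.2)
    · by_cases ht : z.2.2 ≤ 4 / 9
      · simp only [r', if_pos ht]
        exact Or.inl (hrL (hz.2 ⟨_, hcoef _ ht⟩))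
      · simp only [r', if_neg ht]
        exact cellPath_mem hP hhL (Or.inl (norm_ballDir hz.1))
    · rw [hr'3 z hz]
      exact Or.inr ⟨0, rfl⟩
  -- The map to the open set.
  let c : ℝ → ℝ := fun ρ => max 0 (min 1 (6 * ρ - 1))
  have hc0 : ∀ ρ, ρ < 1 / 6 → c ρ = 0 := fun ρ hρ =>
    max_eq_left ((min_le_right _ _).trans (by linarith))
  have hc1 : ∀ ρ, 1 / 3 ≤ ρ → c ρ = 1 := fun ρ hρ => by
    have : min 1 (6 * ρ - 1) = 1 := min_eq_left (by linarith)
    simp only [c, this]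
    norm_num
  -- The cutoff `c` kills `φ` near the centre, where the direction is undefined. It is `1` for `‖y‖
  -- ≥ 1/3`, so there the segment in the definition of `M` is constant; for `‖y‖ < 1/3` the last
  -- coordinate exceeds `2/3`, where nothing is required.
  let e : Metric.closedBall (0 : W) 1 → V × W × ℝ :=
    fun y => (c ‖y.1‖ • φ y.1, (1 - ‖y.1‖) • y.1, 1 - ‖y.1‖)
  have he : Continuous e := by
    have h1 : Continuous fun y : W => c ‖y‖ • φ y := continuous_iff_continuousAt.2 fun y => by
      by_cases hy : y = 0
      · refine (continuousAt_const (y := (0 : V))).congr ?_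
        have h2 : ∀ᶠ y' : W in 𝓝 y, ‖y'‖ < 1 / 6 :=
          (isOpen_lt continuous_norm continuous_const).mem_nhds (by simp [hy])
        filter_upwards [h2] with y' hy'
        rw [hc0 _ hy', zero_smul]
      · exact ContinuousAt.smul (by fun_prop) (hφ y hy)
    have h2 : Continuous fun y : Metric.closedBall (0 : W) 1 => c ‖y.1‖ • φ y.1 :=
      h1.comp continuous_subtype_val
    fun_prop
  have hzero : ∀ y : Metric.closedBall (0 : W) 1, ‖y.1‖ = 1 → e y = (i (P y), 0, 0) :=
    fun y hy => by
      have h1 : φ y.1 = i (P y) := by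
        simp only [φ, ballDir_of_norm_eq_one hy]
      simp only [e, hy, hc1 1 (by norm_num), one_smul, h1, sub_self, zero_smul]
  obtain ⟨i', hi'c, hi'L, hi'P⟩ := exists_extend_range hLcl
    (f := fun x => (i x, (0 : W), (0 : ℝ))) (hi.prodMk continuousOn_const) P.continuous he
    (fun y hy => (hzero y ((hP.mem_iff y).1 hy)).symm) hP.inj
  have hne : ∀ y : Metric.closedBall (0 : W) 1, 0 < ‖y.1‖ → y.1 ≠ 0 := fun y hy =>
    norm_pos_iff.1 hy
  have hφs : ∀ y : Metric.closedBall (0 : W) 1, ‖y.1‖ < 1 → φ ((1 - ‖y.1‖) • y.1) = φ y.1 :=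
    fun y hy => by simp only [φ, ballDir_smul (sub_pos.2 hy)]
  have hle : ∀ y : Metric.closedBall (0 : W) 1, ‖y.1‖ ≤ 1 := fun y =>
    mem_closedBall_zero_iff.1 y.2
  have hi'O : Set.MapsTo i' (L ∪ Set.range P) O' := by
    have h1 : ∀ x ∈ L, i' x ∈ O' := fun x hx => by
      rw [hi'L x hx]
      exact Or.inl ⟨by norm_num, hiO hx⟩
    rintro x (hx | ⟨y, rfl⟩)
    · exact h1 x hx
    · rcases (hle y).eq_or_lt with hy | hy
      · exact h1 _ ((hP.mem_iff y).2 hy)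
      · rw [hi'P]
        rcases lt_or_ge ‖y.1‖ (1 / 3) with hy' | hy'
        · exact Or.inr (Or.inr (by
            change 2 / 3 < 1 - ‖y.1‖
            linarith))
        · refine Or.inr (Or.inl ⟨smul_ne_zero (sub_pos.2 hy).ne' (hne y (by linarith)),
            fun s => ?_⟩)
          simp only [ℓ, e]
          rw [hφs y hy, hc1 _ hy', one_smul, AffineMap.lineMap_same_apply]
          exact hφO (hne y (by linarith))
  -- The homotopy.
  let G₀ : ℝ → ℝ := fun ρ => max 0 (min 2 (9 * ρ - 3))
  have hG0 : ∀ ρ, ρ < 1 / 3 → G₀ ρ = 0 := fun ρ hρ =>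
    max_eq_left ((min_le_right _ _).trans (by linarith))
  have hG2 : ∀ ρ, 5 / 9 ≤ ρ → G₀ ρ = 2 := fun ρ hρ => by
    have : min 2 (9 * ρ - 3) = 2 := min_eq_left (by linarith)
    simp only [G₀, this]
    norm_num
  -- `G₀` is the path parameter of `r' ∘ e`, by `6 - 9 (1 - ρ) = 9 ρ - 3`. On the sphere the
  -- parameter becomes `2 - s`, so the homotopy agrees there with `h`; near the centre it is `s
  -- ‖y‖`, giving the continuous map `P (s y)`.
  let G : Metric.closedBall (0 : W) 1 × I → ℝ :=
    fun q => (1 - q.2) * G₀ ‖q.1.1‖ + q.2 * ‖q.1.1‖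
  have hG : Continuous G := by fun_prop
  let k : Metric.closedBall (0 : W) 1 × I → K := fun q => cellPath P h (ballDir q.1.1, G q)
  have hk : Continuous k := continuous_iff_continuousAt.2 fun q => by
    by_cases hq : q.1.1 = 0
    · have h1 : ContinuousAt (fun q : Metric.closedBall (0 : W) 1 × I => P (ballScale (q.2, q.1)))
          q := by fun_prop
      refine h1.congr ?_
      have h2 : ∀ᶠ q' : Metric.closedBall (0 : W) 1 × I in 𝓝 q, ‖q'.1.1‖ < 1 / 3 :=
        (isOpen_lt (f := fun q : Metric.closedBall (0 : W) 1 × I => ‖q.1.1‖) (by fun_prop)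
          continuous_const).mem_nhds (by simp [hq])
      filter_upwards [h2] with q' hq'
      have h3 : G q' = q'.2 * ‖q'.1.1‖ := by simp only [G, hG0 _ hq', mul_zero, zero_add]
      have h4 : (q'.2 : ℝ) * ‖q'.1.1‖ ∈ Set.Icc (0 : ℝ) 1 :=
        ⟨mul_nonneg q'.2.2.1 (norm_nonneg _), mul_le_one₀ q'.2.2.2 (norm_nonneg _) (hle _)⟩
      have h5 : k q' = P (ballScale (Set.projIcc 0 1 zero_le_one (G q'), ballDir q'.1.1)) :=
        if_pos (by
          change G q' ≤ 1
          rw [h3]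
          exact h4.2)
      rw [h5, h3, Set.projIcc_of_mem _ h4]
      refine congrArg P (Subtype.ext ?_)
      change (q'.2 : ℝ) • q'.1.1 = ((q'.2 : ℝ) * ‖q'.1.1‖) • (ballDir q'.1.1).1
      rw [mul_smul, norm_smul_ballDir]
    · have h1 : ContinuousOn k {q | q.1.1 ≠ 0} := (continuousOn_cellPath hP hh hh1).comp
        (fun q hq => ContinuousAt.continuousWithinAt (ContinuousAt.prodMk
          (ContinuousAt.comp (f := fun q : Metric.closedBall (0 : W) 1 × I => q.1.1) (x := q)
            (continuousAt_ballDir hq) (by fun_prop)) hG.continuousAt))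
        fun q hq => norm_ballDir hq
      exact h1.continuousAt ((isOpen_ne.preimage
        (continuous_subtype_val.comp continuous_fst)).mem_nhds hq)
  let m : Metric.closedBall (0 : W) 1 × I → K × I := fun q => (P q.1, q.2)
  have hbd : ∀ q : Metric.closedBall (0 : W) 1 × I, ‖q.1.1‖ = 1 → h (m q) = k q := fun q hq => by
    have h1 : G q = 2 - q.2 := by
      simp only [G, hq, hG2 1 (by norm_num)]
      ring
    simp only [k, h1, ballDir_of_norm_eq_one hq]
    rw [cellPath_two_sub hP hh1 hq]
  obtain ⟨h', hh'c, hh'L, hh'P⟩ := exists_extend_range (B := {z : K × I | z.1 ∈ L})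
    (hLcl.preimage continuous_fst) hh (m := m) (by fun_prop) hk
    (fun q hq => hbd q ((hP.mem_iff q.1).1 hq))
    (fun q q' hq hqq' => Prod.ext (hP.inj _ _ hq (congrArg Prod.fst hqq'))
      (congrArg (fun z => z.2) hqq'))
  have hcover : ∀ z : K × I, z.1 ∈ L ∪ Set.range P → z ∈ {z : K × I | z.1 ∈ L} ∪ Set.range m := by
    rintro ⟨x, t⟩ (hx | ⟨y, rfl⟩)
    exacts [Or.inl hx, Or.inr ⟨(y, t), rfl⟩]
  refine ⟨V × W × ℝ, inferInstance, inferInstance, inferInstance, O', i', r', h', hO', hi'c, hi'O,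
    hr'c, hr'L, hh'c.mono hcover, fun z hz => ?_, ?_⟩
  · rcases hcover z hz with hz | ⟨q, rfl⟩
    · rw [hh'L z hz]
      exact Or.inl (hhL z hz)
    · rw [hh'P]
      refine cellPath_mem hP hhL ?_
      by_cases hq : q.1.1 = 0
      · right
        have h3 : G q = q.2 * ‖q.1.1‖ := by
          simp only [G, hG0 ‖q.1.1‖ (by simp [hq]), mul_zero, zero_add]
        rw [h3, hq]
        simp
      · exact Or.inl (norm_ballDir hq)
  · have hL01 : ∀ x ∈ L, h' (x, 0) = r' (i' x) ∧ h' (x, 1) = x := fun x hx => by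
      rw [hh'L (x, 0) hx, hh'L (x, 1) hx, hi'L x hx, hr'1 _ (by norm_num)]
      exact hends x hx
    rintro x (hx | ⟨y, rfl⟩)
    · exact hL01 x hx
    rcases (hle y).eq_or_lt with hy | hy
    · exact hL01 _ ((hP.mem_iff y).2 hy)
    constructor
    · refine (hh'P (y, 0)).trans ?_
      have h3 : G (y, 0) = G₀ ‖y.1‖ := by simp [G]
      rw [hi'P]
      simp only [k, h3]
      by_cases hy' : 1 - ‖y.1‖ ≤ 4 / 9
      · have h4 : r' (e y) = r (ℓ (e y) (max 0 (9 * (1 - ‖y.1‖) - 3))) := if_pos hy'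
        rw [h4, hG2 _ (by linarith), hcell2 _ (hne y (by linarith))]
        simp only [ℓ, e]
        rw [hφs y hy, hc1 _ (by linarith), one_smul, AffineMap.lineMap_same_apply]
      · have h4 : r' (e y) =
            cellPath P h (ballDir ((1 - ‖y.1‖) • y.1), max 0 (6 - 9 * (1 - ‖y.1‖))) := if_neg hy'
        have h5 : G₀ ‖y.1‖ = max 0 (6 - 9 * (1 - ‖y.1‖)) := by
          have : min 2 (9 * ‖y.1‖ - 3) = 6 - 9 * (1 - ‖y.1‖) := by
            rw [min_eq_right (by linarith)]
            ring
          simp only [G₀, this]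
        rw [h4, ballDir_smul (sub_pos.2 hy), h5]
    · refine (hh'P (y, 1)).trans ?_
      have h3 : G (y, 1) = ‖y.1‖ := by simp [G]
      simp only [k, h3]
      exact cellPath_norm y

end Attach

theorem CellBuilt.isOpenDominated [T2Space K] [Nonempty K] {L : Set K}
    (h : CellBuilt (∅ : Set K) L) : IsOpenDominated L := by
  induction h with
  | base => exact isOpenDominated_empty
  | attach hL hP ih => exact ih.attach (hL.isClosed isClosed_empty) hP

end Domination

/-! ### Mapping spaces into spaces of the homotopy type of a CW complex -/

namespace CompactLimit

variable {ι : Type w} [Preorder ι] (𝒳 : CompactLimit.{u, w} ι) {K : Type v} [TopologicalSpace K]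
  {K' : Type v'} [TopologicalSpace K']

/-- Composition with a map `K → K'`. -/
def postcomp (f : C(K, K')) : IndSpace.Hom (𝒳.maps K) (𝒳.maps K') where
  f _ := ⟨fun s => f.comp s, ContinuousMap.continuous_postcomp f⟩
  fL := ⟨fun s => f.comp s, ContinuousMap.continuous_postcomp f⟩
  tr_f _ _ := rfl
  toL_f _ _ := rfl

/-- Composition with a homotopy. -/
def compHomotopy {Y K : Type*} [TopologicalSpace Y] [CompactSpace Y] [T2Space Y]
    [TopologicalSpace K] (H : C(I × K, K)) : C(C(Y, K) × I, C(Y, K)) :=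
  ContinuousMap.curry ⟨fun z : (C(Y, K) × I) × Y => H (z.1.2, z.1.1 z.2), by fun_prop⟩

theorem isWeakColimit_maps_of_domination (h : (𝒳.maps K').IsWeakColimit) (f : C(K, K'))
    (g : C(K', K)) (hgf : (g.comp f).Homotopic (ContinuousMap.id K)) :
    (𝒳.maps K).IsWeakColimit := by
  obtain ⟨H⟩ := hgf
  exact h.of_domination (𝒳.postcomp f) (𝒳.postcomp g) (fun _ => compHomotopy H.toContinuousMap)
    (compHomotopy H.toContinuousMap)
    (fun i (s : C(𝒳.X i, K)) => ContinuousMap.ext fun x => H.apply_zero (s x))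
    (fun i (s : C(𝒳.X i, K)) => ContinuousMap.ext fun x => H.apply_one (s x))
    (fun (s : C(𝒳.Y, K)) => ContinuousMap.ext fun x => H.apply_zero (s x))
    (fun (s : C(𝒳.Y, K)) => ContinuousMap.ext fun x => H.apply_one (s x)) fun _ _ _ => rfl

/-- A test problem involves only the images of `S × X i` and `T × Y`, which are compact. -/
theorem isWeakColimit_maps_of_exhaustion
    (hK : ∀ C : Set K, IsCompact C → ∃ L : Set K, C ⊆ L ∧ (𝒳.maps L).IsWeakColimit) :
    (𝒳.maps K).IsWeakColimit := by
  intro T _ _ _ S hS i (a : C(S, C(𝒳.X i, K))) (v : C(T, C(𝒳.Y, K))) hav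
  have : CompactSpace S := isCompact_iff_compactSpace.1 hS.1.isCompact
  obtain ⟨L, hCL, hL⟩ := hK (Set.range a.uncurry ∪ Set.range v.uncurry)
    ((isCompact_range a.uncurry.continuous).union (isCompact_range v.uncurry.continuous))
  have ha : ∀ z, a.uncurry z ∈ L := fun z => hCL (Or.inl ⟨z, rfl⟩)
  have hv : ∀ z, v.uncurry z ∈ L := fun z => hCL (Or.inr ⟨z, rfl⟩)
  let a' : C(S × 𝒳.X i, L) := ⟨fun z => ⟨a.uncurry z, ha z⟩, by fun_prop⟩
  let v' : C(T × 𝒳.Y, L) := ⟨fun z => ⟨v.uncurry z, hv z⟩, by fun_prop⟩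
  obtain ⟨j, hij, c, hc, hcv⟩ := hL T S hS i a'.curry v'.curry fun s =>
    ContinuousMap.ext fun y => Subtype.ext (congrArg (fun f : C(𝒳.Y, K) => f y) (hav s))
  obtain ⟨G, G0, G1, GS⟩ := homotopicRel_iff.1 hcv
  let κ := 𝒳.postcomp (⟨Subtype.val, continuous_subtype_val⟩ : C(L, K))
  refine ⟨j, hij, (κ.f j).comp c, fun s => congrArg (κ.f j) (hc s),
    homotopicRel_iff.2 ⟨κ.fL.comp G, fun t => ?_, fun t => ?_, fun s hs r => ?_⟩⟩
  · exact congrArg κ.fL (G0 t)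
  · exact congrArg κ.fL (G1 t)
  · exact congrArg κ.fL (GS s hs r)

variable [IsDirectedOrder ι]

theorem isWeakColimit_maps_of_isOpenDominated {L : Set K} (h : IsOpenDominated L) :
    (𝒳.maps L).IsWeakColimit := by
  obtain ⟨V, _, _, _, O, i, r, h, hO, hi, hiO, hr, hrL, hh, hhL, hends⟩ := h
  refine 𝒳.isWeakColimit_maps_of_domination (𝒳.isWeakColimit_maps_of_isOpen hO)
    ⟨hiO.restrict i L O, hi.mapsToRestrict hiO⟩ ⟨hrL.restrict r O L, hr.mapsToRestrict hrL⟩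
    ⟨⟨⟨fun z => ⟨h (z.2, z.1), hhL _ z.2.2⟩, ?_⟩, fun x => ?_, fun x => ?_⟩⟩
  · refine Continuous.subtype_mk (hh.comp_continuous (f := fun z : I × L => ((z.2 : K), z.1))
      (by fun_prop) fun z => z.2.2) _
  · exact Subtype.ext (hends x x.2).1
  · exact Subtype.ext (hends x x.2).2

theorem isWeakColimit_maps_of_cwComplex [T2Space K] [Topology.CWComplex (Set.univ : Set K)] :
    (𝒳.maps K).IsWeakColimit := by
  obtain hK | hK := isEmpty_or_nonempty K
  · refine 𝒳.isWeakColimit_maps_of_domination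
      (𝒳.isWeakColimit_maps_of_isOpen (isOpen_empty (X := ℝ)))
      ⟨fun x => isEmptyElim x, continuous_of_const fun x => isEmptyElim x⟩
      ⟨fun x => x.2.elim, continuous_of_const fun x => x.2.elim⟩ ?_
    rw [show ContinuousMap.comp _ _ = ContinuousMap.id K from
      ContinuousMap.ext fun x => isEmptyElim x]
  · refine 𝒳.isWeakColimit_maps_of_exhaustion fun C hC => ?_
    obtain ⟨L, hL, hCL⟩ := exists_cellBuilt_of_isCompact hC
    exact ⟨L, hCL, 𝒳.isWeakColimit_maps_of_isOpenDominated hL.isOpenDominated⟩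

theorem isWeakColimit_maps_of_hasCWType (hK : HasCWType K) : (𝒳.maps K).IsWeakColimit := by
  obtain ⟨K', _, _, _, ⟨e⟩⟩ := hK
  exact 𝒳.isWeakColimit_maps_of_domination 𝒳.isWeakColimit_maps_of_cwComplex e.toFun e.invFun
    e.left_inv

end CompactLimit

/-! ### Fibrations of mapping spaces -/

section Fibrations

variable {E B : Type u} [TopologicalSpace E] [TopologicalSpace B] {p : C(E, B)}

theorem IsFibration.hasHLP (hp : IsFibration p) (Z : Type u) [TopologicalSpace Z] [CompactSpace Z]
    [T2Space Z] : HasHLP Z p :=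
  fun H f h => hp Z H f h

/-- By the exponential law, this is homotopy lifting for the compact Hausdorff space `Y × X`. -/
theorem IsFibration.hasHLP_postcomp (hp : IsFibration p) (X : Type u) [TopologicalSpace X]
    [CompactSpace X] [T2Space X] (Y : Type) [TopologicalSpace Y] [CompactSpace Y] [T2Space Y] :
    HasHLP Y (⟨fun s => p.comp s, ContinuousMap.continuous_postcomp p⟩ : C(C(X, E), C(X, B))) := by
  intro H f hf
  obtain ⟨G, G0, hG⟩ := hp.hasHLP (Y × X)
    ⟨fun z => H (z.1.1, z.2) z.1.2, by fun_prop⟩ f.uncurry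
    (fun z => congrArg (fun s : C(X, B) => s z.2) (hf z.1))
  refine ⟨ContinuousMap.curry ⟨fun z : (Y × I) × X => G ((z.1.1, z.2), z.1.2), by fun_prop⟩,
    fun y => ContinuousMap.ext fun x => G0 (y, x), fun z => ContinuousMap.ext fun x =>
      hG ((z.1, x), z.2)⟩

/-- For a cofibration `A ⊆ X` and a fibration `p : E → B`, the map from `C(X, E)` to the space of
lifting problems is a fibration. -/
theorem IsFibration.hasHLP_square (hp : IsFibration p) {X : Type u} [TopologicalSpace X]
    [CompactSpace X] [T2Space X] {A : Set X} (hA : IsCofib A) {M : Type u} [TopologicalSpace M]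
    (q : C(C(X, E), M)) (π₁ : C(M, C(X, B))) (π₂ : C(M, C(A, E)))
    (hπ : ∀ m m', π₁ m = π₁ m' → π₂ m = π₂ m' → m = m')
    (hM : ∀ m (a : A), p (π₂ m a) = π₁ m a) (hq₁ : ∀ s x, π₁ (q s) x = p (s x))
    (hq₂ : ∀ s (a : A), π₂ (q s) a = s a)
    (Y : Type) [TopologicalSpace Y] [CompactSpace Y] [T2Space Y] : HasHLP Y q := by
  intro H f hf
  have : CompactSpace A := isCompact_iff_compactSpace.1 hA.1.isCompact
  let H₁ : C(Y × I, C(X, B)) := π₁.comp H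
  let H₂ : C(Y × I, C(A, E)) := π₂.comp H
  -- After currying, the lift is prescribed on `Y × (X × {0} ∪ A × I)` and sought on `Y × X × I`.
  have hC : IsTrivCofib {z : Y × (X × I) | z.2.2 = 0 ∨ z.2.1 ∈ A} := hA.isTrivCofib.prod_left Y
  obtain ⟨g, g₁, g₂⟩ := exists_glue (C₁ := {z : Y × (X × I) | z.2.2 = 0})
    (C₂ := {z : Y × (X × I) | z.2.1 ∈ A}) (isClosed_eq (by fun_prop) (by fun_prop))
    (hA.1.preimage (continuous_fst.comp continuous_snd))
    (⟨fun z => f z.1.1 z.1.2.1, by fun_prop⟩ : C(_, E))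
    ⟨fun z => H₂ (z.1.1, z.1.2.2) ⟨z.1.2.1, z.2⟩, by fun_prop⟩ (by
      rintro ⟨y, x, t⟩ (rfl : t = 0) (hx : x ∈ A)
      change f y x = π₂ (H (y, 0)) ⟨x, hx⟩
      rw [← hf, hq₂])
  obtain ⟨G, hGg, hG⟩ := hC.exists_lift (hp.hasHLP (Y × (X × I))) g
    ⟨fun z => H₁ (z.1, z.2.2) z.2.1, by fun_prop⟩ (by
      rintro ⟨⟨y, x, t⟩, ht | hx⟩
      · obtain rfl : t = 0 := ht
        refine (congrArg p (g₁ (y, x, 0) rfl)).trans ?_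
        change p (f y x) = π₁ (H (y, 0)) x
        rw [← hf, hq₁]
      · refine (congrArg p (g₂ (y, x, t) hx)).trans ?_
        exact hM (H (y, t)) ⟨x, hx⟩)
  refine ⟨ContinuousMap.curry ⟨fun z : (Y × I) × X => G (z.1.1, z.2, z.1.2), by fun_prop⟩,
    fun y => ContinuousMap.ext fun x => ?_, fun z => ?_⟩
  · exact (hGg ⟨(y, x, 0), Or.inl rfl⟩).trans (g₁ (y, x, 0) rfl)
  · refine hπ _ _ (ContinuousMap.ext fun x => ?_) (ContinuousMap.ext fun a => ?_)
    · rw [hq₁]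
      exact hG (z.1, x, z.2)
    · rw [hq₂]
      exact (hGg ⟨(z.1, a.1, z.2), Or.inr a.2⟩).trans (g₂ (z.1, a.1, z.2) a.2)

/-- Apply homotopy extension with target `X × {0} ∪ A × I` itself, which is compact Hausdorff and
hence an admissible test space. -/
theorem IsClosedCofibration.isCofib {X : Type u} [TopologicalSpace X] [CompactSpace X] [T2Space X]
    {A : Set X} (hA : IsClosedCofibration A) : IsCofib A := by
  have : CompactSpace {z : X × I | z.2 = 0 ∨ z.1 ∈ A} :=
    isCompact_iff_compactSpace.1 (isClosed_zero_or_mem hA.1).isCompact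
  obtain ⟨G, G0, GA⟩ := hA.2 {z : X × I | z.2 = 0 ∨ z.1 ∈ A}
    ⟨fun x => ⟨(x, 0), Or.inl rfl⟩, by fun_prop⟩
    ⟨fun z => ⟨(z.1.1, z.2), Or.inr z.1.2⟩, by fun_prop⟩ fun a => rfl
  refine ⟨hA.1, ⟨fun z => (G z).1, by fun_prop⟩, fun z => (G z).2, ?_⟩
  rintro ⟨x, t⟩ (ht | hx)
  · obtain rfl : t = 0 := ht
    exact congrArg Subtype.val (G0 x)
  · exact congrArg Subtype.val (GA ⟨x, hx⟩ t)

theorem IsFiniteCWPair.isCofib {X : Type u} [TopologicalSpace X] {A : Set X}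
    (h : IsFiniteCWPair A) : IsCofib A := by
  obtain ⟨_, _, _, L, rfl⟩ := h
  exact (cellBuilt_univ L).isCofib L.closed

theorem IsFiniteCWPair.compactSpace {X : Type u} [TopologicalSpace X] {A : Set X}
    (h : IsFiniteCWPair A) : CompactSpace X := by
  obtain ⟨_, _, _, -⟩ := h
  have h1 : CellBuilt (∅ : Set X) Set.univ := by
    rw [← Topology.CWComplex.skeletonLT_zero_eq_empty (C := (Set.univ : Set X))]
    exact cellBuilt_univ _
  exact isCompact_univ_iff.1 (h1.isCompact isCompact_empty)

end Fibrations

/-! ### Homotopy groups of weak colimits -/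

namespace IndSpace

variable {ι : Type w} [Preorder ι]

/-- The restriction of a direct system to the indices above `m`. -/
def restrict (𝒰 : IndSpace.{u, w} ι) (m : ι) : IndSpace.{u, w} (Set.Ici m) where
  U i := 𝒰.U i
  L := 𝒰.L
  tr h := 𝒰.tr h
  toL i := 𝒰.toL i
  tr_tr hij hjk := 𝒰.tr_tr hij hjk
  toL_tr hij := 𝒰.toL_tr hij

/-- The restriction of a morphism of direct systems to the indices above `m`. -/
def Hom.restrict {𝒰 𝒱 : IndSpace.{u, w} ι} (φ : Hom 𝒰 𝒱) (m : ι) :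
    Hom (𝒰.restrict m) (𝒱.restrict m) where
  f i := φ.f i
  fL := φ.fL
  tr_f h := φ.tr_f (Subtype.coe_le_coe.2 h)
  toL_f i := φ.toL_f i

theorem IsWeakColimit.restrict {𝒰 : IndSpace.{u, w} ι} (h : 𝒰.IsWeakColimit) (m : ι) :
    (𝒰.restrict m).IsWeakColimit := by
  intro T _ _ _ S hS i a v hav
  obtain ⟨j, hij, c, hc⟩ := h T S hS i a v hav
  exact ⟨⟨j, le_trans i.2 hij⟩, hij, c, hc⟩

/-- The constant direct system at a point. -/
def point (ι : Type w) [Preorder ι] : IndSpace.{u, w} ι where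
  U _ := PUnit
  L := PUnit
  tr _ := ContinuousMap.id _
  toL _ := ContinuousMap.id _
  tr_tr _ _ _ := rfl
  toL_tr _ _ := rfl

theorem isWeakColimit_point : (point.{u} ι).IsWeakColimit :=
  fun _ _ _ _ _ _ i _ v _ => ⟨i, le_refl i, v, fun _ => rfl, ContinuousMap.HomotopicRel.refl v⟩

/-- Weak colimits are detected by the maps from compact Hausdorff spaces. -/
theorem IsWeakColimit.of_hom {𝒰 : IndSpace.{u, w} ι} {𝒱 : IndSpace.{v, w} ι}
    (h𝒱 : 𝒱.IsWeakColimit) (φ : Hom 𝒰 𝒱) (hφ : ∀ i, Function.Injective (φ.f i))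
    (hφL : Function.Injective φ.fL)
    (hlift : ∀ (T : Type) [TopologicalSpace T] [CompactSpace T] [T2Space T] (i : ι)
      (g : C(T, 𝒱.U i)), ∃ g' : C(T, 𝒰.U i), ∀ t, φ.f i (g' t) = g t)
    (hliftL : ∀ (T : Type) [TopologicalSpace T] [CompactSpace T] [T2Space T]
      (g : C(T, 𝒱.L)), ∃ g' : C(T, 𝒰.L), ∀ t, φ.fL (g' t) = g t) :
    𝒰.IsWeakColimit := by
  intro T _ _ _ S hS i a v hav
  obtain ⟨j, hij, c, hc, hcv⟩ := h𝒱 T S hS i ((φ.f i).comp a) (φ.fL.comp v) fun s =>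
    (congrArg φ.fL (hav s)).trans (φ.toL_f i (a s)).symm
  obtain ⟨G, G0, G1, GS⟩ := homotopicRel_iff.1 hcv
  obtain ⟨c', hc'⟩ := hlift T j c
  obtain ⟨G', hG'⟩ := hliftL (T × I) G
  refine ⟨j, hij, c', fun s => hφ j ?_, homotopicRel_iff.2 ⟨G', fun t => hφL ?_, fun t => hφL ?_,
    fun s hs r => hφL ?_⟩⟩
  · rw [hc', hc, ← φ.tr_f]
    rfl
  · rw [hG', G0]
    change 𝒱.toL j (c t) = φ.fL (𝒰.toL j (c' t))
    rw [← hc', φ.toL_f]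
  · rw [hG', G1]
    rfl
  · rw [hG', GS s hs]
    change 𝒱.toL j (c s) = φ.fL (𝒰.toL j (c' s))
    rw [← hc', φ.toL_f]

variable {𝒰 : IndSpace.{u, w} ι}

/-- Every loop in a weak colimit comes from a finite stage. -/
theorem IsWeakColimit.exists_loop (h : 𝒰.IsWeakColimit) {n : ℕ} {i : ι} {x : 𝒰.U i}
    {y : 𝒰.L} (hxy : 𝒰.toL i x = y) (a : GenLoop (Fin n) 𝒰.L y) :
    ∃ (j : ι) (hij : i ≤ j) (b : C(Fin n → I, 𝒰.U j)),
      (∀ t ∈ Cube.boundary (Fin n), b t = 𝒰.tr hij x) ∧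
        ((𝒰.toL j).comp b).HomotopicRel a.1 (Cube.boundary (Fin n)) := by
  obtain ⟨j, hij, b, hb, hba⟩ := h _ _ (isCofib_boundary_cube n) i (ContinuousMap.const _ x) a.1
    fun s => (a.2 s s.2).trans hxy.symm
  exact ⟨j, hij, b, fun t ht => hb ⟨t, ht⟩, hba⟩

/-- Relatively homotopic maps into a weak colimit are relatively homotopic at a finite stage. -/
theorem IsWeakColimit.exists_homotopicRel (h : 𝒰.IsWeakColimit) {T : Type} [TopologicalSpace T]
    [CompactSpace T] [T2Space T] {S : Set T} (hS : IsCofib S) {i : ι} {a b : C(T, 𝒰.U i)}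
    (hab : ∀ s ∈ S, a s = b s)
    (H : ((𝒰.toL i).comp a).HomotopicRel ((𝒰.toL i).comp b) S) :
    ∃ (j : ι) (hij : i ≤ j), ((𝒰.tr hij).comp a).HomotopicRel ((𝒰.tr hij).comp b) S := by
  obtain ⟨G, G0, G1, GS⟩ := homotopicRel_iff.1 H
  obtain ⟨g, g0, g1, gS⟩ := exists_glue_endpoints hS.1 a b hab
  -- Only the strict extension of the boundary data matters here; how `c` compares with `G` in the
  -- limit is irrelevant.
  obtain ⟨j, hij, c, hc, -⟩ := h (T × I) _ hS.prod_interval i g G (by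
    rintro ⟨⟨t, r⟩, (hr | hr) | ht⟩
    · obtain rfl : r = 0 := hr
      exact (G0 t).trans (congrArg _ (g0 t).symm)
    · obtain rfl : r = 1 := hr
      exact (G1 t).trans (congrArg _ (g1 t).symm)
    · exact (GS t ht r).trans (congrArg _ (gS t ht r).symm))
  refine ⟨j, hij, homotopicRel_iff.2 ⟨c, fun t => ?_, fun t => ?_, fun s hs r => ?_⟩⟩
  · exact (hc ⟨(t, 0), Or.inl (Or.inl rfl)⟩).trans (congrArg _ (g0 t))
  · exact (hc ⟨(t, 1), Or.inl (Or.inr rfl)⟩).trans (congrArg _ (g1 t))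
  · exact (hc ⟨(s, r), Or.inr hs⟩).trans (congrArg _ (gS s hs r))

end IndSpace

/-! ### Spaces of solutions -/

namespace LiftingProblem

variable {X E B : Type u} [TopologicalSpace X] [TopologicalSpace E] [TopologicalSpace B]
  {A : Set X} {p : C(E, B)} {D : LiftingProblem A p}

/-- The inclusion of the space of solutions in the space of maps. -/
theorem continuous_solution_val :
    Continuous (fun s : D.Γ => (s.1 : C(X, E))) := by
  refine continuous_from_compactlyGenerated
    (X := {s : C(X, E) // (∀ a : A, s a = D.g a) ∧ ∀ x, p (s x) = D.f x}) _ fun _ g => ?_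
  exact continuous_subtype_val.comp g.continuous

/-- A compact Hausdorff source is itself a test space for the compactly generated topology, so maps
out of it do not see the change of topology. `ULift` moves it to the universe of the test spaces. -/
theorem continuous_solution_mk {T : Type} [TopologicalSpace T] [CompactSpace T] [T2Space T]
    {f : T → D.Γ} (hf : Continuous fun t => ((f t).1 : C(X, E))) : Continuous f := by
  let Y := {s : C(X, E) // (∀ a : A, s a = D.g a) ∧ ∀ x, p (s x) = D.f x}
  let F : (Σ (i : (T : CompHaus.{u}) × C(T, Y)), i.fst) → Y := fun ⟨⟨_, i⟩, s⟩ => i s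
  have h : @Continuous _ Y inferInstance (TopologicalSpace.compactlyGenerated.{u} Y) F :=
    continuous_coinduced_rng
  let g : C(CompHaus.of (ULift.{u} T), Y) :=
    ⟨fun t => f t.down, (hf.comp continuous_uliftDown).subtype_mk _⟩
  have hg : Continuous fun t : ULift.{u} T => f t.down :=
    (@continuous_sigma_iff _ _ _ _ (TopologicalSpace.compactlyGenerated.{u} Y) F).1 h
      ⟨CompHaus.of (ULift.{u} T), g⟩
  exact hg.comp continuous_uliftUp

end LiftingProblem

/-! ### Solution spaces in the limit -/

namespace PairSystem

variable {ι : Type w} [Preorder ι] {S : PairSystem.{u, w} ι} {X : Type u} [TopologicalSpace X]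
  {A : Set X} {c : S.Cone A}

theorem Cone.IsLimit.ext (hc : c.IsLimit) {x y : X} (h : ∀ i, c.h i x = c.h i y) :
    x = y :=
  hc.1.injective (Subtype.ext (funext h))

theorem Cone.IsLimit.exists_lift (hc : c.IsLimit) (x : ∀ i, S.X i)
    (hx : ∀ (i j : ι) (hij : i ≤ j), S.p hij (x j) = x i) : ∃ y, ∀ i, c.h i y = x i := by
  obtain ⟨y, hy⟩ := hc.1.surjective ⟨x, hx⟩
  exact ⟨y, fun i => congrFun (congrArg Subtype.val hy) i⟩

theorem Cone.IsLimit.exists_lift_mem (hc : c.IsLimit) (x : ∀ i, S.X i)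
    (hx : ∀ (i j : ι) (hij : i ≤ j), S.p hij (x j) = x i) (hA : ∀ i, x i ∈ S.A i) :
    ∃ y ∈ A, ∀ i, c.h i y = x i := by
  have h : (⟨x, hx⟩ : S.lim) ∈ c.toLim '' A := by
    rw [hc.2]
    exact hA
  obtain ⟨y, hyA, hy⟩ := h
  exact ⟨y, hyA, fun i => congrFun (congrArg Subtype.val hy) i⟩

section Solutions

variable {E B : Type u} [TopologicalSpace E] [TopologicalSpace B] {p : C(E, B)} {m : ι}
  (D : LiftingProblem (S.A m) p)

/-- The direct system of the spaces of solutions. -/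
def solutions (c : S.Cone A) : IndSpace.{u, w} (Set.Ici m) where
  U j := (stage S D j).Γ
  L := (limProblem S D c).Γ
  tr h := trans S D h
  toL j := toLimProblem S D c j
  tr_tr hij hjk s := Subtype.ext (ContinuousMap.ext fun x => congrArg s.1 (S.p_comp hij hjk x))
  toL_tr hij s := Subtype.ext (ContinuousMap.ext fun x => congrArg s.1 (c.compat hij x))

variable [IsDirectedOrder ι]

theorem naturalMap_surjective (h : (solutions D c).IsWeakColimit) (n : ℕ) (s : D.Γ) :
    Function.Surjective (naturalMap S D c n s) := by
  rintro ⟨a⟩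
  obtain ⟨j, hij, b, hb, hba⟩ := h.exists_loop (i := ⟨m, le_refl m⟩)
    (x := stageBase S D s ⟨m, le_refl m⟩) (toLimProblem_base S D c s _) a
  exact ⟨Quotient.mk _ ⟨j, Quotient.mk _ ⟨b, fun t ht =>
    (hb t ht).trans (trans_base S D s hij)⟩⟩, Quotient.sound hba⟩

theorem naturalMap_injective (h : (solutions D c).IsWeakColimit) (n : ℕ) (s : D.Γ) :
    Function.Injective (naturalMap S D c n s) := by
  intro x y
  induction x, y using DirectLimit.induction₂ with | ih j x y => ?_
  induction x using Quotient.inductionOn with | h a => ?_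
  induction y using Quotient.inductionOn with | h b => ?_
  intro hab
  obtain ⟨k, hjk, H⟩ := h.exists_homotopicRel (isCofib_boundary_cube n) (i := j) (a := a.1)
    (b := b.1) (fun t ht => (a.2 t ht).trans (b.2 t ht).symm) (Quotient.exact hab)
  exact Quotient.sound ⟨k, hjk, hjk, Quotient.sound H⟩

end Solutions

/-! ### Mapping spaces of the pairs and spaces of lifting problems -/

variable [CompactSpace X] [T2Space X]

/-- The inverse system of the total spaces. -/
def Cone.IsLimit.total (hc : c.IsLimit) (hS : ∀ j, IsFiniteCWPair (S.A j)) :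
    CompactLimit.{u, w} ι :=
  have (i : ι) : CompactSpace (S.X i) := (hS i).compactSpace
  have (i : ι) : T2Space (S.X i) := (hS i).1
  { X := S.X
    Y := X
    p := S.p
    h := c.h
    p_p := S.p_comp
    p_h := c.compat
    ext := fun _ _ => hc.ext
    exists_lift := hc.exists_lift }

/-- The inverse system of the subspaces. -/
def Cone.IsLimit.sub (hc : c.IsLimit) (hS : ∀ j, IsFiniteCWPair (S.A j)) (hA : IsClosed A) :
    CompactLimit.{u, w} ι :=
  have (i : ι) : CompactSpace (S.X i) := (hS i).compactSpace
  have (i : ι) : T2Space (S.X i) := (hS i).1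
  have (i : ι) : CompactSpace (S.A i) :=
    isCompact_iff_compactSpace.1 (hS i).isCofib.1.isCompact
  have : CompactSpace A := isCompact_iff_compactSpace.1 hA.isCompact
  { X := fun i => S.A i
    Y := A
    p := fun h => ⟨(S.mapsTo h).restrict _ _ _, (S.p h).continuous.restrict _⟩
    h := fun i => ⟨(c.mapsTo i).restrict _ _ _, (c.h i).continuous.restrict _⟩
    p_p := fun hij hjk x => Subtype.ext (S.p_comp hij hjk x)
    p_h := fun hij y => Subtype.ext (c.compat hij y)
    ext := fun _ _ h => Subtype.ext (hc.ext fun i => congrArg Subtype.val (h i))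
    exists_lift := fun x hx => by
      obtain ⟨y, hy, h⟩ := hc.exists_lift_mem (fun i => x i)
        (fun i j hij => congrArg Subtype.val (hx i j hij)) fun i => (x i).2
      exact ⟨⟨y, hy⟩, fun i => Subtype.ext (h i)⟩ }

/-- Restriction of maps to the subspaces. -/
def Cone.IsLimit.restrictMaps (hc : c.IsLimit) (hS : ∀ j, IsFiniteCWPair (S.A j))
    (hA : IsClosed A) (K : Type u) [TopologicalSpace K] :
    IndSpace.Hom ((hc.total hS).maps K) ((hc.sub hS hA).maps K) where
  f i := ⟨fun s : C(S.X i, K) => s.comp ⟨Subtype.val, continuous_subtype_val⟩,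
    ContinuousMap.continuous_precomp _⟩
  fL := ⟨fun s : C(X, K) => s.comp ⟨Subtype.val, continuous_subtype_val⟩,
    ContinuousMap.continuous_precomp _⟩
  tr_f _ _ := rfl
  toL_f _ _ := rfl

variable {E B : Type u} [TopologicalSpace E] [TopologicalSpace B] (p : C(E, B))

/-- The direct system of the spaces of lifting problems. -/
def Cone.IsLimit.problems (hc : c.IsLimit) (hS : ∀ j, IsFiniteCWPair (S.A j))
    (hA : IsClosed A) : IndSpace.{u, w} ι :=
  IndSpace.pullback (hc.restrictMaps hS hA B) ((hc.sub hS hA).postcomp p)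

/-- The lifting problems solved by given maps. -/
def Cone.IsLimit.toProblems (hc : c.IsLimit) (hS : ∀ j, IsFiniteCWPair (S.A j))
    (hA : IsClosed A) : IndSpace.Hom ((hc.total hS).maps E) (hc.problems p hS hA) where
  f i := ⟨fun s => ⟨(((hc.total hS).postcomp p).f i s, (hc.restrictMaps hS hA E).f i s), rfl⟩,
    by fun_prop⟩
  fL := ⟨fun s => ⟨(((hc.total hS).postcomp p).fL s, (hc.restrictMaps hS hA E).fL s), rfl⟩,
    by fun_prop⟩
  tr_f _ _ := rfl
  toL_f _ _ := rfl

variable {p} {m : ι} (D : LiftingProblem (S.A m) p)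

/-- The stages of a lifting problem. -/
def Cone.IsLimit.stages (hc : c.IsLimit) (hS : ∀ j, IsFiniteCWPair (S.A j))
    (hA : IsClosed A) :
    IndSpace.Hom (IndSpace.point (Set.Ici m)) ((hc.problems p hS hA).restrict m) where
  f _ := ContinuousMap.const _ ⟨((stage S D _).f, (stage S D _).g),
    ContinuousMap.ext fun a => ((stage S D _).comm a).symm⟩
  fL := ContinuousMap.const _ ⟨((limProblem S D c).f, (limProblem S D c).g),
    ContinuousMap.ext fun a => ((limProblem S D c).comm a).symm⟩
  tr_f {i _} h _ := Subtype.ext (Prod.ext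
    (ContinuousMap.ext fun x => congrArg D.f (S.p_comp i.2 h x))
    (ContinuousMap.ext fun a => congrArg D.g (Subtype.ext (S.p_comp i.2 h a.1))))
  toL_f i _ := Subtype.ext (Prod.ext
    (ContinuousMap.ext fun x => congrArg D.f (c.compat i.2 x))
    (ContinuousMap.ext fun a => congrArg D.g (Subtype.ext (c.compat i.2 a.1))))

/-- Solutions of the stages of a lifting problem, as maps inducing the given problem. -/
def Cone.IsLimit.solutionsHom (hc : c.IsLimit) (hS : ∀ j, IsFiniteCWPair (S.A j))
    (hA : IsClosed A) :
    IndSpace.Hom (solutions D c)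
      (IndSpace.pullback (hc.stages D hS hA) ((hc.toProblems p hS hA).restrict m)) where
  f _ := ⟨fun s => ⟨(PUnit.unit, s.1), Subtype.ext (Prod.ext
      (ContinuousMap.ext fun x => (s.2.2 x).symm) (ContinuousMap.ext fun a => (s.2.1 a).symm))⟩,
    (continuous_const.prodMk LiftingProblem.continuous_solution_val).subtype_mk _⟩
  fL := ⟨fun s => ⟨(PUnit.unit, s.1), Subtype.ext (Prod.ext
      (ContinuousMap.ext fun x => (s.2.2 x).symm) (ContinuousMap.ext fun a => (s.2.1 a).symm))⟩,
    (continuous_const.prodMk LiftingProblem.continuous_solution_val).subtype_mk _⟩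
  tr_f _ _ := rfl
  toL_f _ _ := rfl

variable [IsDirectedOrder ι]

/-- Two applications of stability under pullback: first to the spaces of lifting problems, then to
the fibre of `C(X, E)` over the given one. -/
theorem isWeakColimit_solutions (hc : c.IsLimit) (hS : ∀ j, IsFiniteCWPair (S.A j))
    (hA : IsClosedCofibration A) (hE : HasCWType E) (hB : HasCWType B) (hp : IsFibration p) :
    (solutions D c).IsWeakColimit := by
  have hM : (hc.problems p hS hA.1).IsWeakColimit :=
    ((hc.total hS).isWeakColimit_maps_of_hasCWType hB).pullback
      ((hc.sub hS hA.1).isWeakColimit_maps_of_hasCWType hE)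
      ((hc.sub hS hA.1).isWeakColimit_maps_of_hasCWType hB) _ _
      (fun i Y _ _ _ => hp.hasHLP_postcomp ((hc.sub hS hA.1).X i) Y)
      (fun Y _ _ _ => hp.hasHLP_postcomp (hc.sub hS hA.1).Y Y)
  -- The pullback carries the compact-open topology and the solution spaces its compactly generated
  -- refinement; compact Hausdorff test spaces do not distinguish them.
  refine IndSpace.IsWeakColimit.of_hom ?_ (hc.solutionsHom D hS hA.1) ?_ ?_ ?_ ?_
  · refine IndSpace.isWeakColimit_point.pullback
      (((hc.total hS).isWeakColimit_maps_of_hasCWType hE).restrict m) (hM.restrict m) _ _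
      (fun i Y _ _ _ => ?_) fun Y _ _ _ => ?_
    · have := (hS i).compactSpace
      have := (hS i).1
      exact hp.hasHLP_square (hS i).isCofib ((hc.toProblems p hS hA.1).f i)
        ⟨fun y => y.1.1, by fun_prop⟩ ⟨fun y => y.1.2, by fun_prop⟩
        (fun _ _ h h' => Subtype.ext (Prod.ext h h'))
        (fun y a => (congrArg (fun f : C(S.A i, B) => f a) y.2).symm)
        (fun _ _ => rfl) (fun _ _ => rfl) Y
    · exact hp.hasHLP_square hA.isCofib (hc.toProblems p hS hA.1).fL
        ⟨fun y => y.1.1, by fun_prop⟩ ⟨fun y => y.1.2, by fun_prop⟩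
        (fun _ _ h h' => Subtype.ext (Prod.ext h h'))
        (fun y a => (congrArg (fun f : C(A, B) => f a) y.2).symm)
        (fun _ _ => rfl) (fun _ _ => rfl) Y
  · intro j s s' h
    exact Subtype.ext (congrArg (fun y => y.1.2) h)
  · intro s s' h
    exact Subtype.ext (congrArg (fun y => y.1.2) h)
  · intro T _ _ _ j g
    have hg : ∀ t, (stage S D j).f = p.comp (g t).1.2 ∧
        (stage S D j).g = (g t).1.2.comp ⟨Subtype.val, continuous_subtype_val⟩ :=
      fun t => Prod.ext_iff.1 (congrArg Subtype.val (g t).2)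
    refine ⟨⟨fun t => ⟨(g t).1.2, fun a => (DFunLike.congr_fun (hg t).2 a).symm,
      fun x => (DFunLike.congr_fun (hg t).1 x).symm⟩,
      LiftingProblem.continuous_solution_mk (by fun_prop)⟩, fun t => rfl⟩
  · intro T _ _ _ g
    have hg : ∀ t, (limProblem S D c).f = p.comp (g t).1.2 ∧
        (limProblem S D c).g = (g t).1.2.comp ⟨Subtype.val, continuous_subtype_val⟩ :=
      fun t => Prod.ext_iff.1 (congrArg Subtype.val (g t).2)
    refine ⟨⟨fun t => ⟨(g t).1.2, fun a => (DFunLike.congr_fun (hg t).2 a).symm,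
      fun x => (DFunLike.congr_fun (hg t).1 x).symm⟩,
      LiftingProblem.continuous_solution_mk (by fun_prop)⟩, fun t => rfl⟩

end PairSystem

end LimSection

theorem theorem6p6 {ι : Type w} [Preorder ι] [IsDirectedOrder ι]
    (S : LimSection.PairSystem.{u, w} ι)
    (hS : ∀ j, LimSection.IsFiniteCWPair (S.A j))
    {X : Type u} [TopologicalSpace X] [CompactSpace X] [T2Space X] {A : Set X}
    (hA : LimSection.IsClosedCofibration A)
    (c : S.Cone A) (hc : c.IsLimit)
    {E B : Type u} [TopologicalSpace E] [T2Space E] [CompactlyGeneratedSpace E]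
    [TopologicalSpace B] [T2Space B] [CompactlyGeneratedSpace B]
    (hE : LimSection.HasCWType E) (hB : LimSection.HasCWType B)
    (p : C(E, B)) (hp : LimSection.IsFibration p)
    (m : ι) (D : LimSection.LiftingProblem (S.A m) p) (s : D.Γ) (n : ℕ) :
    LimSection.naturalMap S D c n s (LimSection.colimBase S D n s) =
        LimSection.piBase n (LimSection.limBase S D c s) ∧
      Function.Bijective (LimSection.naturalMap S D c n s) := by
  have h := LimSection.PairSystem.isWeakColimit_solutions D hc hS hA hE hB hp
  exact ⟨(LimSection.piMap n _ (LimSection.toLimProblem_base S D c s _)).map_base,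
    LimSection.PairSystem.naturalMap_injective D h n s,
    LimSection.PairSystem.naturalMap_surjective D h n s⟩
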